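/- Let $R$ be a noetherian commutative ring, let $n\ge 0$, and let $I$ be an ideal of $R[[t]][x_1,\dots,x_n]$ that is $x$-homogeneous, i.e. generated by elements that are homogeneous as polynomials in $x_1,\dots,x_n$ over $R[[t]]$. For $w\in\mathbb{R}_{<0}\times\mathbb{R}^n$ and $f=\sum_{\beta,\alpha}c_{\beta,\alpha}t^\beta x^\alpha\in R[[t]][x_1,\dots,x_n]$ let the initial form $\operatorname{in}_w(f)\in R[t,x_1,\dots,x_n]$ be the (finite) sum of those terms $c_{\beta,\alpha}t^\beta x^\alpha$ with $c_{\beta,\alpha}\neq 0$ for which $w\cdot(\beta,\alpha)$ is maximal, and let $\operatorname{in}_w(I)\subseteq R[t,x_1,\dots,x_n]$ be the ideal generated by all $\operatorname{in}_w(f)$ with $f\in I$. Put $$C_w(I)=\overline{\{v\in\mathbb{R}_{<0}\times\mathbb{R}^n \mid \operatorname{in}_v(I)=\operatorname{in}_w(I)\}}\quad\text{(Euclidean closure)},$$ $$C_w^{0}(I)=C_w(I)\cap(\{0\}\times\mathbb{R}^n),\qquad C_w^{-1}(I)=C_w(I)\cap(\{-1\}\times\mathbb{R}^n).$$ A polyhedron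 is a finite intersection of closed affine half-spaces, a polyhedral cone a finite intersection of closed linear half-spaces, and a face of a polyhedron is a nonempty set consisting of all points of the polyhedron at which some fixed linear functional attains its maximum over the polyhedron. A polyhedral complex is a finite collection of nonempty polyhedra that contains all faces of its members and in which any two members are either disjoint or intersect in a face of both; a polyhedral fan is a finite collection of polyhedral cones that contains all faces of its members and in which any two members intersect in a face of both. The support of a collection is the union of its members. Then: 1. The collection $\{C_w^{-1}(I)\mid w\in\mathbb{R}_{<0}\times\mathbb{R}^n\}$ is a polyhedral complex whose support is the affine hyperplane $\{-1\}\times\mathbb{R}^n$. 2. For every $w\in\mathbb{R}_{<0}\times\mathbb{R}^n$, the boundary cone $C_w^0(I)$ is the recession cone of $C_w^{-1}(I)$: $$C_w^0(I)=\{v\in\mathbb{R}_{\le 0}\times\mathbb{R}^n\mid v+C_w^{-1}(I)\subseteq C_w^{-1}(I)\}.$$ 3. The collection $\{C_w^0(I)\mid w\in\mathbb{R}_{<0}\times\mathbb{R}^n\}$ is a polyhedral fan whose support is the hyperplane $\{0\}\times\mathbb{R}^n$. -/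

import Mathlib

/-! ### Polyhedral geometry -/

section Polyhedral

variable {E : Type*} [AddCommGroup E] [Module ℝ E] [TopologicalSpace E]

/-- A polyhedron: a finite intersection of closed affine half-spaces. -/
def IsPolyhedron (P : Set E) : Prop :=
  ∃ s : Finset (StrongDual ℝ E × ℝ), P = {x | ∀ p ∈ s, p.1 x ≤ p.2}

/-- A polyhedral cone: a finite intersection of closed linear half-spaces. -/
def IsPolyhedralCone (C : Set E) : Prop :=
  ∃ s : Finset (StrongDual ℝ E), C = {x | ∀ l ∈ s, l x ≤ 0}

/-- `F` is a (nonempty) face of `P`: the nonempty set of all points of `P` at which some linear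
functional attains its maximum on `P`. The functional `0` shows that a nonempty `P` is a face of
itself. -/
def IsFaceOf (F P : Set E) : Prop :=
  F.Nonempty ∧ IsExposed ℝ P F

/-- A (finite) polyhedral complex: a finite collection of nonempty polyhedra which contains every
face of each of its members, and in which two members that meet do so in a face of both. -/
structure IsPolyhedralComplex (K : Set (Set E)) : Prop where
  finite : K.Finite
  nonempty : ∀ P ∈ K, P.Nonempty
  polyhedron : ∀ P ∈ K, IsPolyhedron P
  face_mem : ∀ P ∈ K, ∀ F, IsFaceOf F P → F ∈ K
  inter : ∀ P ∈ K, ∀ Q ∈ K, (P ∩ Q).Nonempty → IsFaceOf (P ∩ Q) P ∧ IsFaceOf (P ∩ Q) Q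

/-- A polyhedral fan: a finite collection of polyhedral cones which contains every face of each
of its members, and in which the intersection of two members is a face of both. -/
structure IsPolyhedralFan (K : Set (Set E)) : Prop where
  finite : K.Finite
  cone : ∀ C ∈ K, IsPolyhedralCone C
  face_mem : ∀ C ∈ K, ∀ F, IsFaceOf F C → F ∈ K
  inter : ∀ C ∈ K, ∀ D ∈ K, IsFaceOf (C ∩ D) C ∧ IsFaceOf (C ∩ D) D

end Polyhedral

/-! ### Initial forms and initial ideals

The ring `R⟦t⟧[x₁, …, xₙ]` is `MvPolynomial (Fin n) (PowerSeries R)` and `R[t, x₁, …, xₙ]` is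
`MvPolynomial (Fin n) (Polynomial R)`. The monomial `t ^ β * x ^ α` is encoded by the exponent
vector `(β, α) : ℕ × (Fin n →₀ ℕ)`, and weight vectors are elements of `ℝ × (Fin n → ℝ)`. -/

section Groebner

variable {R : Type*} [CommRing R] {n : ℕ}

/-- The coefficient of `t ^ β * x ^ α` in `f`, for `m = (β, α)`. -/
noncomputable def coeffTX (f : MvPolynomial (Fin n) (PowerSeries R)) (m : ℕ × (Fin n →₀ ℕ)) : R :=
  PowerSeries.coeff m.1 (MvPolynomial.coeff m.2 f)

/-- The scalar product `w · (β, α)`. -/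
def weightDeg (w : ℝ × (Fin n → ℝ)) (m : ℕ × (Fin n →₀ ℕ)) : ℝ :=
  w.1 * (m.1 : ℝ) + ∑ i, w.2 i * (m.2 i : ℝ)

/-- The exponent vectors of the monomials of `f` that have maximal `w`-weight among all monomials
of `f`. -/
def maxExponents (w : ℝ × (Fin n → ℝ)) (f : MvPolynomial (Fin n) (PowerSeries R)) :
    Set (ℕ × (Fin n →₀ ℕ)) :=
  {m | coeffTX f m ≠ 0 ∧ ∀ m', coeffTX f m' ≠ 0 → weightDeg w m' ≤ weightDeg w m}

/-- For `w` with `w₀ < 0`, only finitely many monomials of `f` have maximal weight, so that the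
sum in the definition of the initial form is a genuine finite sum. -/
theorem maxExponents_finite {w : ℝ × (Fin n → ℝ)} (hw : w.1 < 0)
    (f : MvPolynomial (Fin n) (PowerSeries R)) : (maxExponents w f).Finite := by
  refine Set.Finite.of_finite_image (f := Prod.snd) (f.support.finite_toSet.subset ?_) ?_
  · rintro _ ⟨m, hm, rfl⟩
    have h : MvPolynomial.coeff m.2 f ≠ 0 := by
      intro h0
      exact hm.1 (by simp [coeffTX, h0])
    simpa using h
  · rintro ⟨a, c⟩ ha ⟨b, d⟩ hb hab
    obtain rfl : c = d := hab
    have h : weightDeg w (a, c) = weightDeg w (b, c) :=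
      le_antisymm (hb.2 _ ha.1) (ha.2 _ hb.1)
    have h' : (a : ℝ) = b := by
      simpa [weightDeg, hw.ne] using h
    rw [Nat.cast_injective h']

/-- The initial form of `f` with respect to `w`: the sum of the terms of `f` of maximal
`w`-weight. It is used only for weight vectors `w` with `w₀ < 0`. -/
noncomputable def initialForm (w : ℝ × (Fin n → ℝ)) (f : MvPolynomial (Fin n) (PowerSeries R)) :
    MvPolynomial (Fin n) (Polynomial R) :=
  ∑ᶠ m ∈ maxExponents w f, MvPolynomial.monomial m.2 (Polynomial.monomial m.1 (coeffTX f m))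

/-- The initial ideal of `I` with respect to `w`, an ideal of `R[t, x₁, …, xₙ]`. -/
noncomputable def initialIdeal (w : ℝ × (Fin n → ℝ))
    (I : Ideal (MvPolynomial (Fin n) (PowerSeries R))) :
    Ideal (MvPolynomial (Fin n) (Polynomial R)) :=
  Ideal.span (initialForm w '' (I : Set (MvPolynomial (Fin n) (PowerSeries R))))

/-- An ideal of `R⟦t⟧[x₁, …, xₙ]` is `x`-homogeneous if it is generated by elements that are
homogeneous as polynomials in `x₁, …, xₙ` over `R⟦t⟧`. -/
def IsXHomogeneous (I : Ideal (MvPolynomial (Fin n) (PowerSeries R))) : Prop :=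
  ∃ S : Set (MvPolynomial (Fin n) (PowerSeries R)),
    (∀ f ∈ S, ∃ d : ℕ, f.IsHomogeneous d) ∧ Ideal.span S = I

/-! ### Gröbner cones -/

/-- The interior Gröbner cone `C_w(I)`: the closure of the set of all `v` with `v₀ < 0` that
induce the same initial ideal as `w`. -/
def groebnerCone (I : Ideal (MvPolynomial (Fin n) (PowerSeries R))) (w : ℝ × (Fin n → ℝ)) :
    Set (ℝ × (Fin n → ℝ)) :=
  closure {v | v.1 < 0 ∧ initialIdeal v I = initialIdeal w I}

/-- The boundary Gröbner cone `C_w⁰(I) = C_w(I) ∩ ({0} × ℝⁿ)`. -/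
def boundaryCone (I : Ideal (MvPolynomial (Fin n) (PowerSeries R))) (w : ℝ × (Fin n → ℝ)) :
    Set (ℝ × (Fin n → ℝ)) :=
  groebnerCone I w ∩ {0} ×ˢ Set.univ

/-- The slice `C_w⁻¹(I) = C_w(I) ∩ ({-1} × ℝⁿ)`. -/
def groebnerSlice (I : Ideal (MvPolynomial (Fin n) (PowerSeries R))) (w : ℝ × (Fin n → ℝ)) :
    Set (ℝ × (Fin n → ℝ)) :=
  groebnerCone I w ∩ {-1} ×ˢ Set.univ

/-- The recession cone of a subset `P` of `ℝ × ℝⁿ`: the vectors of `ℝ_{≤ 0} × ℝⁿ` under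
translation by which `P` is closed. -/
def recessionCone (P : Set (ℝ × (Fin n → ℝ))) : Set (ℝ × (Fin n → ℝ)) :=
  {v | v.1 ≤ 0 ∧ ∀ p ∈ P, v + p ∈ P}

end Groebner

/-! ### Coefficient calculus for series and polynomials, and parts supported on sets of exponents.
-/

section Coefficients

/-! Fix `w` and put `J = in_w(I)`. Since `R` is only a noetherian ring, no monomial order is used.
Instead exponents are grouped into the classes that no weight making `J` homogeneous can separate.
`J` is graded by these classes, and they are finite because `w` and the `x`-degree are among the
weights. Division with remainder works class by class: a class part lying in `J` is removed by means
of lifts of generators of `J`, which only creates terms of lower `w`-weight in the same `x`-degree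
(`IsLiftSystem.exists_reduction`).

Reducing the tails gives lifts `F g ∈ I` of class-homogeneous generators `g` of `J` that behave like
a reduced Gröbner basis: `in_v(I) = J` exactly when `in_v(F g) = g` for all `g`. For `v` with
negative first coordinate only the lowest power of `t` at each `x`-monomial matters, so this amounts
to finitely many linear equations and strict inequalities. On the closed cone, `in_v(I)` is
generated by the `in_v(F g)` and depends only on which inequalities are tight
(`exists_isCellDescription`). Hence the cone of a point of a Gröbner cone is the smallest face
containing it. That there are finitely many initial ideals follows by taking limits of initial forms
along an ultrafilter (`finite_initialIdeals`).

The slices then form a complex by linear programming with tight inequalities, and the boundary cone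
of a nonempty slice is its recession cone. Recession cones of a polyhedral complex need not form a
fan; here the complex covers the whole hyperplane. For a direction `x₀`, the finitely many closed
sets of points whose rays in direction `x₀` end up in a given slice cover `{-1} × ℝⁿ`. Where two of
them meet, the smallest faces containing `x₀` of the two boundary cones agree. By connectedness they
always agree (`coneFace_boundaryCone_eq`), which gives the intersection property. -/

/-- Exponent vectors `(β, α)` of the monomials `t ^ β * x ^ α`. -/
abbrev ExpVec (n : ℕ) := ℕ × (Fin n →₀ ℕ)

/-- The ring `R⟦t⟧[x₁, …, xₙ]`. -/
abbrev XSeries (R : Type*) [CommRing R] (n : ℕ) := MvPolynomial (Fin n) (PowerSeries R)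

/-- The ring `R[t, x₁, …, xₙ]`. -/
abbrev TXPoly (R : Type*) [CommRing R] (n : ℕ) := MvPolynomial (Fin n) (Polynomial R)

variable {R : Type*} [CommRing R] {n : ℕ}

/-- The pairs of exponent vectors with sum `m`. -/
noncomputable def expAntidiagonal (m : ExpVec n) : Finset (ExpVec n × ExpVec n) :=
  (Finset.HasAntidiagonal.antidiagonal m.1 ×ˢ Finset.HasAntidiagonal.antidiagonal m.2).image
    fun p => ((p.1.1, p.2.1), (p.1.2, p.2.2))

@[simp] theorem mem_expAntidiagonal {m : ExpVec n} {x : ExpVec n × ExpVec n} :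
    x ∈ expAntidiagonal m ↔ x.1 + x.2 = m := by
  obtain ⟨⟨a, b⟩, ⟨c, d⟩⟩ := x
  obtain ⟨k, l⟩ := m
  simp [expAntidiagonal, Prod.ext_iff]

theorem coeffTX_mul (f g : XSeries R n) (m : ExpVec n) :
    coeffTX (f * g) m = ∑ x ∈ expAntidiagonal m, coeffTX f x.1 * coeffTX g x.2 := by
  unfold expAntidiagonal
  rw [Finset.sum_image]
  · simp only [coeffTX, MvPolynomial.coeff_mul, map_sum, PowerSeries.coeff_mul]
    rw [Finset.sum_product_right]
  · rintro ⟨⟨a, b⟩, ⟨c, d⟩⟩ - ⟨⟨a', b'⟩, ⟨c', d'⟩⟩ - h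
    simp_all

theorem coeffTX_add (f g : XSeries R n) (m : ExpVec n) :
    coeffTX (f + g) m = coeffTX f m + coeffTX g m := by simp [coeffTX]

theorem coeffTX_sub (f g : XSeries R n) (m : ExpVec n) :
    coeffTX (f - g) m = coeffTX f m - coeffTX g m := by simp [coeffTX]

@[simp] theorem coeffTX_zero (m : ExpVec n) : coeffTX (0 : XSeries R n) m = 0 := by
  simp [coeffTX]

theorem coeffTX_sum {ι : Type*} (s : Finset ι) (f : ι → XSeries R n) (m : ExpVec n) :
    coeffTX (∑ i ∈ s, f i) m = ∑ i ∈ s, coeffTX (f i) m := by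
  simp [coeffTX, MvPolynomial.coeff_sum]

theorem coeffTX_ext {f g : XSeries R n} (h : ∀ m, coeffTX f m = coeffTX g m) : f = g := by
  ext a k
  exact h (k, a)

theorem exists_coeffTX_ne_zero {f : XSeries R n} (h : f ≠ 0) : ∃ m, coeffTX f m ≠ 0 := by
  by_contra! h'
  exact h (coeffTX_ext fun m => by simp [h' m])

theorem exists_of_coeffTX_mul_ne_zero {f g : XSeries R n} {m : ExpVec n}
    (h : coeffTX (f * g) m ≠ 0) :
    ∃ a b, a + b = m ∧ coeffTX f a ≠ 0 ∧ coeffTX g b ≠ 0 := by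
  rw [coeffTX_mul] at h
  obtain ⟨x, hx, hne⟩ := Finset.exists_ne_zero_of_sum_ne_zero h
  exact ⟨x.1, x.2, mem_expAntidiagonal.1 hx, left_ne_zero_of_mul hne, right_ne_zero_of_mul hne⟩

/-- The coefficient of `t ^ β * x ^ α` in a polynomial. -/
noncomputable def coeffP (g : TXPoly R n) (m : ExpVec n) : R :=
  Polynomial.coeff (MvPolynomial.coeff m.2 g) m.1

/-- The inclusion of `R[t, x₁, …, xₙ]` into `R⟦t⟧[x₁, …, xₙ]`. -/
noncomputable def toSeries : TXPoly R n →+* XSeries R n :=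
  MvPolynomial.map Polynomial.coeToPowerSeries.ringHom

@[simp] theorem coeffTX_toSeries (g : TXPoly R n) (m : ExpVec n) :
    coeffTX (toSeries g) m = coeffP g m := by
  simp [coeffTX, toSeries, coeffP, MvPolynomial.coeff_map]

theorem coeffP_add (f g : TXPoly R n) (m : ExpVec n) :
    coeffP (f + g) m = coeffP f m + coeffP g m := by simp [coeffP]

@[simp] theorem coeffP_zero (m : ExpVec n) : coeffP (0 : TXPoly R n) m = 0 := by simp [coeffP]

theorem coeffP_sum {ι : Type*} (s : Finset ι) (f : ι → TXPoly R n) (m : ExpVec n) :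
    coeffP (∑ i ∈ s, f i) m = ∑ i ∈ s, coeffP (f i) m := by
  simp [coeffP, MvPolynomial.coeff_sum]

theorem coeffP_mul (f g : TXPoly R n) (m : ExpVec n) :
    coeffP (f * g) m = ∑ x ∈ expAntidiagonal m, coeffP f x.1 * coeffP g x.2 := by
  simp only [← coeffTX_toSeries, map_mul, coeffTX_mul]

theorem coeffP_ext {f g : TXPoly R n} (h : ∀ m, coeffP f m = coeffP g m) : f = g := by
  ext a k
  exact h (k, a)

theorem exists_coeffP_ne_zero {f : TXPoly R n} (h : f ≠ 0) : ∃ m, coeffP f m ≠ 0 := by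
  by_contra! h'
  exact h (coeffP_ext fun m => by simp [h' m])

theorem finite_coeffP_support (g : TXPoly R n) : (Function.support (coeffP g)).Finite := by
  have : Function.support (coeffP g) ⊆
      ⋃ a ∈ g.support, (fun k => (k, a)) '' ((MvPolynomial.coeff a g).support : Set ℕ) := by
    rintro ⟨k, a⟩ h
    have h1 : MvPolynomial.coeff a g ≠ 0 := by
      intro h0; exact h (by simp [coeffP, h0])
    simp only [Set.mem_iUnion]
    exact ⟨a, MvPolynomial.mem_support_iff.2 h1, k, Finset.mem_coe.2 (Polynomial.mem_support_iff.2 h), rfl⟩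
  refine Set.Finite.subset ?_ this
  exact Set.Finite.biUnion g.support.finite_toSet fun a _ => (Finset.finite_toSet _).image _

/-- The term `c * t ^ β * x ^ α`. -/
noncomputable def term (m : ExpVec n) (c : R) : TXPoly R n :=
  MvPolynomial.monomial m.2 (Polynomial.monomial m.1 c)

theorem coeffP_term (m m' : ExpVec n) (c : R) :
    coeffP (term m c) m' = if m = m' then c else 0 := by
  classical
  obtain ⟨a, b⟩ := m
  obtain ⟨a', b'⟩ := m'
  simp only [coeffP, term, MvPolynomial.coeff_monomial, Prod.mk.injEq]
  split_ifs with h1 h2 h2 <;> simp_all [Polynomial.coeff_monomial]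

theorem coeffTX_term_mul (m m' : ExpVec n) (c : R) (f : XSeries R n) :
    coeffTX (toSeries (term m c) * f) (m + m') = c * coeffTX f m' := by
  rw [coeffTX_mul, Finset.sum_eq_single (m, m')]
  · simp [coeffP_term]
  · rintro ⟨a, b⟩ hab hne
    simp only [mem_expAntidiagonal] at hab
    simp only [coeffTX_toSeries, coeffP_term]
    rw [if_neg, zero_mul]
    rintro rfl
    exact hne (by simpa using hab)
  · simp

theorem exists_of_coeffTX_term_mul_ne_zero {m m' : ExpVec n} {c : R} {f : XSeries R n}
    (h : coeffTX (toSeries (term m c) * f) m' ≠ 0) : ∃ b, m' = m + b ∧ coeffTX f b ≠ 0 := by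
  obtain ⟨a, b, hab, ha, hb⟩ := exists_of_coeffTX_mul_ne_zero h
  rw [coeffTX_toSeries, coeffP_term] at ha
  obtain rfl : m = a := by
    by_contra hne
    simp [hne] at ha
  exact ⟨b, hab.symm, hb⟩

/-- The polynomial with the given finitely supported coefficient function. -/
noncomputable def polyOf (c : ExpVec n → R) : TXPoly R n := ∑ᶠ m, term m (c m)

theorem coeffP_polyOf {c : ExpVec n → R} (hc : (Function.support c).Finite) (m : ExpVec n) :
    coeffP (polyOf c) m = c m := by
  classical
  unfold polyOf
  rw [finsum_eq_sum_of_support_subset (s := hc.toFinset), coeffP_sum]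
  · simp only [coeffP_term]
    simp +contextual [eq_comm]
  · intro m' h
    simp only [Set.Finite.coe_toFinset, Function.mem_support]
    rintro h0
    exact h (by simp [h0, term])

/-- The part of `g` with exponents in `P`. -/
noncomputable def restr (P : Set (ExpVec n)) (g : TXPoly R n) : TXPoly R n :=
  polyOf (P.indicator (coeffP g))

theorem coeffP_restr (P : Set (ExpVec n)) (g : TXPoly R n) (m : ExpVec n) [Decidable (m ∈ P)] :
    coeffP (restr P g) m = if m ∈ P then coeffP g m else 0 := by
  rw [restr, coeffP_polyOf]
  · simp [Set.indicator_apply]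
  · refine (finite_coeffP_support g).subset ?_
    intro m h
    simp_all

theorem coeffP_restr_of_mem {P : Set (ExpVec n)} {m : ExpVec n} (h : m ∈ P) (g : TXPoly R n) :
    coeffP (restr P g) m = coeffP g m := by
  classical
  simp [coeffP_restr, h]

theorem coeffP_restr_of_notMem {P : Set (ExpVec n)} {m : ExpVec n} (h : m ∉ P)
    (g : TXPoly R n) : coeffP (restr P g) m = 0 := by
  classical
  simp [coeffP_restr, h]

theorem restr_add (P : Set (ExpVec n)) (f g : TXPoly R n) :
    restr P (f + g) = restr P f + restr P g := by
  classical
  refine coeffP_ext fun m => ?_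
  simp only [coeffP_restr, coeffP_add]
  split_ifs <;> simp

@[simp] theorem restr_zero (P : Set (ExpVec n)) : restr P (0 : TXPoly R n) = 0 := by
  classical
  refine coeffP_ext fun m => ?_
  simp [coeffP_restr]

theorem restr_restr (P Q : Set (ExpVec n)) (g : TXPoly R n) :
    restr P (restr Q g) = restr (P ∩ Q) g := by
  classical
  refine coeffP_ext fun m => ?_
  simp only [coeffP_restr, Set.mem_inter_iff]
  split_ifs <;> simp_all

/-- A polynomial is the sum of its parts on the fibres of `φ`. -/
theorem sum_restr_fiber {X : Type*} [DecidableEq X] (φ : ExpVec n → X) (g : TXPoly R n) :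
    ∑ x ∈ (finite_coeffP_support g).toFinset.image φ, restr {m | φ m = x} g = g := by
  classical
  refine coeffP_ext fun m => ?_
  rw [coeffP_sum, Finset.sum_eq_single (φ m)]
  · exact coeffP_restr_of_mem (P := {m' | φ m' = φ m}) rfl g
  · intro x _ hx
    exact coeffP_restr_of_notMem (fun h => hx (Eq.symm h)) g
  · intro h
    rw [coeffP_restr_of_mem (P := {m' | φ m' = φ m}) rfl g]
    by_contra hne
    exact h (Finset.mem_image_of_mem _ (by simpa using hne))

/-- The support is finite, so only finitely many fibres contribute. This is how membership is tested
one graded piece at a time throughout. -/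
theorem mem_of_forall_restr_fiber_mem {X : Type*} {J : Ideal (TXPoly R n)} (φ : ExpVec n → X)
    {g : TXPoly R n} (h : ∀ x, restr {m | φ m = x} g ∈ J) : g ∈ J := by
  classical
  rw [← sum_restr_fiber φ g]
  exact J.sum_mem fun x _ => h x

/-- Reduces multiplication by a polynomial to multiplication by a term, which shifts every weight by
a constant. -/
theorem term_induction {p : TXPoly R n → Prop} (g : TXPoly R n) (h0 : p 0)
    (hadd : ∀ f g, p f → p g → p (f + g)) (hterm : ∀ m c, p (term m c)) : p g := by
  classical
  have : g = ∑ m ∈ (finite_coeffP_support g).toFinset, term m (coeffP g m) := by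
    refine coeffP_ext fun m => ?_
    simp only [coeffP_sum, coeffP_term]
    rw [Finset.sum_ite_eq']
    split_ifs with h
    · rfl
    · simpa using h
  rw [this]
  exact Finset.sum_induction _ p hadd h0 fun m _ => hterm m _

end Coefficients

/-! ### Weights, initial forms and `x`-homogeneous components. -/

section InitialForms

variable {R : Type*} [CommRing R] {n : ℕ}

theorem weightDeg_add (w : ℝ × (Fin n → ℝ)) (a b : ExpVec n) :
    weightDeg w (a + b) = weightDeg w a + weightDeg w b := by
  simp only [weightDeg, Prod.fst_add, Prod.snd_add, Finsupp.add_apply, Nat.cast_add, mul_add,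
    Finset.sum_add_distrib]
  ring

theorem weightDeg_add_weight (v w : ℝ × (Fin n → ℝ)) (a : ExpVec n) :
    weightDeg (v + w) a = weightDeg v a + weightDeg w a := by
  simp only [weightDeg, Prod.fst_add, Prod.snd_add, Pi.add_apply, add_mul,
    Finset.sum_add_distrib]
  ring

theorem weightDeg_smul_weight (c : ℝ) (w : ℝ × (Fin n → ℝ)) (a : ExpVec n) :
    weightDeg (c • w) a = c * weightDeg w a := by
  simp only [weightDeg, Prod.smul_fst, Prod.smul_snd, Pi.smul_apply, smul_eq_mul, mul_assoc,
    mul_add, Finset.mul_sum]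

/-- The weight of the exponent vector `m`, as a continuous linear functional of the weight. -/
noncomputable def weightFunctional (m : ExpVec n) : StrongDual ℝ (ℝ × (Fin n → ℝ)) :=
  LinearMap.toContinuousLinearMap
    { toFun := fun w => weightDeg w m
      map_add' := fun v w => weightDeg_add_weight v w m
      map_smul' := fun c w => weightDeg_smul_weight c w m }

@[simp] theorem weightFunctional_apply (m : ExpVec n) (w : ℝ × (Fin n → ℝ)) :
    weightFunctional m w = weightDeg w m := rfl

/-- The weight vector which measures the degree in `x`. -/
def xDegWeight (n : ℕ) : ℝ × (Fin n → ℝ) := (0, fun _ => 1)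

theorem weightDeg_xDegWeight (m : ExpVec n) :
    weightDeg (xDegWeight n) m = (m.2.degree : ℝ) := by
  simp [weightDeg, xDegWeight, Finsupp.degree_eq_sum]

/-- `f` is homogeneous of degree `d` in `x`. -/
theorem isHomogeneous_iff_coeffTX {f : XSeries R n} {d : ℕ} :
    f.IsHomogeneous d ↔ ∀ m : ExpVec n, coeffTX f m ≠ 0 → m.2.degree = d := by
  constructor
  · intro h m hm
    have : MvPolynomial.coeff m.2 f ≠ 0 := by
      intro h0; exact hm (by simp [coeffTX, h0])
    have := h this
    exact (DFunLike.congr_fun Finsupp.degree_eq_weight_one m.2).trans this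
  · intro h a ha
    obtain ⟨k, hk⟩ : ∃ k, PowerSeries.coeff k (MvPolynomial.coeff a f) ≠ 0 := by
      by_contra! h'
      exact ha (PowerSeries.ext fun k => by simp [h' k])
    exact (DFunLike.congr_fun Finsupp.degree_eq_weight_one a).symm.trans (h (k, a) hk)

/-- There are only finitely many exponent vectors of a fixed `x`-degree whose `p`-weight is bounded
below. -/
theorem finite_setOf_le_weightDeg {p : ℝ × (Fin n → ℝ)} (hp : p.1 < 0) (d : ℕ) (c : ℝ) :
    {m : ExpVec n | m.2.degree = d ∧ c ≤ weightDeg p m}.Finite := by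
  have hfin : {a : Fin n →₀ ℕ | a.degree = d}.Finite := by
    exact (Finsupp.finite_of_degree_le d).subset fun a ha => le_of_eq ha
  have : {m : ExpVec n | m.2.degree = d ∧ c ≤ weightDeg p m} ⊆
      ⋃ a ∈ {a : Fin n →₀ ℕ | a.degree = d}, (fun k => (k, a)) ''
        {k : ℕ | (k : ℝ) ≤ (∑ i, p.2 i * (a i : ℝ) - c) / (-p.1)} := by
    rintro ⟨k, a⟩ ⟨h1, h2⟩
    simp only [Set.mem_iUnion]
    refine ⟨a, h1, k, ?_, rfl⟩
    simp only [weightDeg] at h2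
    simp only [Set.mem_ofPred_eq]
    rw [le_div_iff₀ (by linarith)]
    linarith
  refine (Set.Finite.biUnion hfin fun a _ => Set.Finite.image _ ?_).subset this
  refine (Set.finite_Iic ⌊(∑ i, p.2 i * (a i : ℝ) - c) / (-p.1)⌋₊).subset ?_
  intro k hk
  exact Nat.le_floor hk

theorem coeffP_initialForm {w : ℝ × (Fin n → ℝ)} (hw : w.1 < 0) (f : XSeries R n)
    (m : ExpVec n) [Decidable (m ∈ maxExponents w f)] :
    coeffP (initialForm w f) m = if m ∈ maxExponents w f then coeffTX f m else 0 := by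
  classical
  have hfin := maxExponents_finite hw f
  have : initialForm w f = polyOf ((maxExponents w f).indicator (coeffTX f)) := by
    unfold initialForm polyOf
    refine finsum_congr fun m => ?_
    by_cases h : m ∈ maxExponents w f
    · simp [h, term]
    · simp [h, term]
  rw [this, coeffP_polyOf (hfin.subset (by simp))]
  simp [Set.indicator_apply]

/-- The lowest exponent vectors of `f`, one for each monomial in `x` which occurs in `f`. -/
noncomputable def lowExp (f : XSeries R n) : Finset (ExpVec n) :=
  f.support.image fun a => ((MvPolynomial.coeff a f).order.toNat, a)

theorem coeffTX_ne_zero_of_mem_lowExp {f : XSeries R n} {m : ExpVec n} (h : m ∈ lowExp f) :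
    coeffTX f m ≠ 0 := by
  simp only [lowExp, Finset.mem_image] at h
  obtain ⟨a, ha, rfl⟩ := h
  exact PowerSeries.coeff_order (MvPolynomial.mem_support_iff.1 ha)

theorem exists_mem_lowExp {f : XSeries R n} {m : ExpVec n} (h : coeffTX f m ≠ 0) :
    ∃ m' ∈ lowExp f, m'.2 = m.2 ∧ m'.1 ≤ m.1 := by
  have hne : MvPolynomial.coeff m.2 f ≠ 0 := by
    intro h0; exact h (by simp [coeffTX, h0])
  refine ⟨(_, m.2), Finset.mem_image_of_mem _ (MvPolynomial.mem_support_iff.2 hne), rfl, ?_⟩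
  have := PowerSeries.order_le m.1 h
  exact ENat.toNat_le_of_le_natCast this

theorem weightDeg_le_of_fst_le {w : ℝ × (Fin n → ℝ)} (hw : w.1 ≤ 0) {m m' : ExpVec n}
    (h : m'.2 = m.2) (h' : m'.1 ≤ m.1) : weightDeg w m ≤ weightDeg w m' := by
  simp only [weightDeg, h]
  have : (m'.1 : ℝ) ≤ m.1 := by exact_mod_cast h'
  nlinarith

theorem eq_of_weightDeg_le {w : ℝ × (Fin n → ℝ)} (hw : w.1 < 0) {m m' : ExpVec n}
    (h : m'.2 = m.2) (h' : m'.1 ≤ m.1) (h'' : weightDeg w m' ≤ weightDeg w m) : m = m' := by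
  refine Prod.ext ?_ h.symm
  by_contra hne
  have hlt : m'.1 < m.1 := lt_of_le_of_ne h' (Ne.symm hne)
  simp only [weightDeg, h] at h''
  have : (m'.1 : ℝ) < m.1 := by exact_mod_cast hlt
  nlinarith

/-- At a fixed `x`-monomial, raising the power of `t` strictly lowers the weight. The finite set
`lowExp f` does not depend on `w`, so all questions about initial forms of `f` become finite. -/
theorem maxExponents_subset_lowExp {w : ℝ × (Fin n → ℝ)} (hw : w.1 < 0) (f : XSeries R n) :
    maxExponents w f ⊆ lowExp f := by
  intro m hm
  obtain ⟨m', hm', h1, h2⟩ := exists_mem_lowExp hm.1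
  rwa [eq_of_weightDeg_le hw h1 h2 (hm.2 _ (coeffTX_ne_zero_of_mem_lowExp hm'))]

theorem maxExponents_nonempty {w : ℝ × (Fin n → ℝ)} (hw : w.1 < 0) {f : XSeries R n}
    (hf : f ≠ 0) : (maxExponents w f).Nonempty := by
  obtain ⟨m, hm⟩ := exists_coeffTX_ne_zero hf
  obtain ⟨m', hm', -⟩ := exists_mem_lowExp hm
  obtain ⟨a, ha, hmax⟩ := Finset.exists_max_image (lowExp f) (weightDeg w) ⟨m', hm'⟩
  refine ⟨a, coeffTX_ne_zero_of_mem_lowExp ha, fun b hb => ?_⟩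
  obtain ⟨b', hb', h1, h2⟩ := exists_mem_lowExp hb
  exact (weightDeg_le_of_fst_le hw.le h1 h2).trans (hmax _ hb')

/-- A top-weight description of the initial form: if `f` has no weights above `c` and one of
weight `c`, then the initial form is the part of weight `c`. -/
theorem coeffP_initialForm_of_le {w : ℝ × (Fin n → ℝ)} (hw : w.1 < 0) {f : XSeries R n} {c : ℝ}
    (hle : ∀ m, coeffTX f m ≠ 0 → weightDeg w m ≤ c)
    (hc : ∃ m, coeffTX f m ≠ 0 ∧ weightDeg w m = c) (m : ExpVec n) :
    coeffP (initialForm w f) m = if weightDeg w m = c then coeffTX f m else 0 := by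
  classical
  rw [coeffP_initialForm hw]
  obtain ⟨a, ha, hac⟩ := hc
  by_cases hm : coeffTX f m = 0
  · simp [hm]
  · congr 1
    simp only [maxExponents, Set.mem_ofPred_eq, eq_iff_iff]
    constructor
    · rintro ⟨h1, h2⟩
      exact le_antisymm (hle _ h1) (hac ▸ h2 a ha)
    · rintro h
      exact ⟨hm, fun b hb => h ▸ hle b hb⟩

theorem initialForm_zero (w : ℝ × (Fin n → ℝ)) : initialForm w (0 : XSeries R n) = 0 := by
  simp [initialForm, maxExponents]

theorem exists_top_weight {w : ℝ × (Fin n → ℝ)} (hw : w.1 < 0) {f : XSeries R n}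
    (hf : f ≠ 0) : ∃ c, (∀ m, coeffTX f m ≠ 0 → weightDeg w m ≤ c) ∧
      ∃ m, coeffTX f m ≠ 0 ∧ weightDeg w m = c := by
  obtain ⟨m, hm⟩ := maxExponents_nonempty hw hf
  exact ⟨_, hm.2, m, hm.1, rfl⟩

/-- Homogeneous components of elements of an `x`-homogeneous ideal belong to the ideal. -/
theorem IsXHomogeneous.homogeneousComponent_mem {I : Ideal (XSeries R n)} (hI : IsXHomogeneous I)
    {f : XSeries R n} (hf : f ∈ I) (d : ℕ) : MvPolynomial.homogeneousComponent d f ∈ I := by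
  obtain ⟨S, hS, rfl⟩ := hI
  let := MvPolynomial.gradedAlgebra (σ := Fin n) (R := PowerSeries R)
  refine (MvPolynomial.mem_iff_homogeneousComponent_mem (Ideal.homogeneous_span _ _ ?_) f).1 hf d
  intro f hf
  obtain ⟨d, hd⟩ := hS f hf
  exact ⟨d, hd⟩

theorem coeffTX_homogeneousComponent (f : XSeries R n) (d : ℕ) (m : ExpVec n) :
    coeffTX (MvPolynomial.homogeneousComponent d f) m =
      if m.2.degree = d then coeffTX f m else 0 := by
  classical
  simp only [coeffTX, MvPolynomial.coeff_homogeneousComponent]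
  split_ifs <;> simp

end InitialForms

/-! ### Gradings of an ideal by weights and by homogeneity classes. -/

section Homogeneity

variable {R : Type*} [CommRing R] {n : ℕ}

/-- The weight vectors with respect to which the ideal `J` is homogeneous. -/
def homogeneityWeights (J : Ideal (TXPoly R n)) : Set (ℝ × (Fin n → ℝ)) :=
  {u | ∀ h ∈ J, ∀ c : ℝ, restr {m | weightDeg u m = c} h ∈ J}

/-- On a piece of bidegree `(x, y)` for `u` and `v` the weight of `u + a • v` is the constant `x + a
* y`, so restricting to a fixed weight keeps the piece entirely or kills it. -/
theorem add_smul_mem_homogeneityWeights {J : Ideal (TXPoly R n)} {u v : ℝ × (Fin n → ℝ)}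
    (hu : u ∈ homogeneityWeights J) (hv : v ∈ homogeneityWeights J) (a : ℝ) :
    u + a • v ∈ homogeneityWeights J := by
  intro h hh c
  refine mem_of_forall_restr_fiber_mem (weightDeg u) fun x => ?_
  refine mem_of_forall_restr_fiber_mem (weightDeg v) fun y => ?_
  rw [restr_restr, restr_restr]
  by_cases hc : x + a * y = c
  · convert hu _ (hv h hh y) x using 1
    rw [restr_restr]
    congr 1
    ext m
    simp only [Set.mem_inter_iff, Set.mem_ofPred_eq, weightDeg_add_weight, weightDeg_smul_weight]
    constructor
    · rintro ⟨⟨h1, h2⟩, h3⟩; exact ⟨h2, h1⟩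
    · rintro ⟨h1, h2⟩; exact ⟨⟨h2, h1⟩, by rw [h1, h2, hc]⟩
  · convert J.zero_mem
    refine coeffP_ext fun m => ?_
    rw [coeffP_restr_of_notMem, coeffP_zero]
    simp only [Set.mem_inter_iff, Set.mem_ofPred_eq, weightDeg_add_weight, weightDeg_smul_weight]
    rintro ⟨⟨h1, h2⟩, h3⟩
    exact hc (by rw [← h1, ← h2, h3])

theorem restr_weight_term_mul (u : ℝ × (Fin n → ℝ)) (c : ℝ) (m₀ : ExpVec n) (r : R)
    (h : TXPoly R n) :
    restr {m | weightDeg u m = c} (term m₀ r * h) =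
      term m₀ r * restr {m | weightDeg u m = c - weightDeg u m₀} h := by
  classical
  refine coeffP_ext fun m => ?_
  by_cases hm : ∃ b, m = m₀ + b
  · obtain ⟨b, rfl⟩ := hm
    have key : ∀ g : TXPoly R n, coeffP (term m₀ r * g) (m₀ + b) = r * coeffP g b := fun g => by
      rw [← coeffTX_toSeries, map_mul, coeffTX_term_mul, coeffTX_toSeries]
    rw [coeffP_restr, key, key, coeffP_restr]
    simp only [Set.mem_ofPred_eq, weightDeg_add, eq_sub_iff_add_eq']
    split_ifs <;> simp
  · have key : ∀ g : TXPoly R n, coeffP (term m₀ r * g) m = 0 := fun g => by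
      by_contra hne
      rw [← coeffTX_toSeries, map_mul] at hne
      obtain ⟨b, hb, -⟩ := exists_of_coeffTX_term_mul_ne_zero hne
      exact hm ⟨b, hb⟩
    rw [coeffP_restr, key, key, ite_self]

theorem restr_eq_self_of_forall {P : Set (ExpVec n)} {g : TXPoly R n}
    (h : ∀ m, coeffP g m ≠ 0 → m ∈ P) : restr P g = g := by
  classical
  refine coeffP_ext fun m => ?_
  rw [coeffP_restr]
  split_ifs with hm
  · rfl
  · by_contra hne
    exact hm (h m (Ne.symm hne))

theorem restr_eq_zero_of_forall {P : Set (ExpVec n)} {g : TXPoly R n}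
    (h : ∀ m, coeffP g m ≠ 0 → m ∉ P) : restr P g = 0 := by
  classical
  refine coeffP_ext fun m => ?_
  rw [coeffP_restr, coeffP_zero]
  split_ifs with hm
  · by_contra hne
    exact h m hne hm
  · rfl

/-- An ideal generated by `u`-homogeneous elements is `u`-homogeneous. -/
theorem mem_homogeneityWeights_of_span {G : Set (TXPoly R n)} {u : ℝ × (Fin n → ℝ)}
    (hG : ∀ g ∈ G, ∀ m m', coeffP g m ≠ 0 → coeffP g m' ≠ 0 → weightDeg u m = weightDeg u m') :
    u ∈ homogeneityWeights (Ideal.span G) := by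
  intro h hh
  induction hh using Submodule.span_induction with
  | mem g hg =>
    intro c
    by_cases hc : ∃ m, coeffP g m ≠ 0 ∧ weightDeg u m = c
    · obtain ⟨m, hm, hmc⟩ := hc
      rw [restr_eq_self_of_forall]
      · exact Ideal.subset_span hg
      · intro m' hm'
        exact (hG g hg m' m hm' hm).trans hmc
    · rw [restr_eq_zero_of_forall]
      · exact Ideal.zero_mem _
      · intro m hm hmc
        exact hc ⟨m, hm, hmc⟩
  | zero => intro c; rw [restr_zero]; exact Ideal.zero_mem _
  | add x y _ _ hx hy =>
    intro c
    rw [restr_add]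
    exact Ideal.add_mem _ (hx c) (hy c)
  | smul a x _ hx =>
    intro c
    rw [smul_eq_mul]
    induction a using term_induction generalizing c with
    | h0 => rw [zero_mul, restr_zero]; exact Ideal.zero_mem _
    | hadd f g hf hg =>
      rw [add_mul, restr_add]
      exact Ideal.add_mem _ (hf c) (hg c)
    | hterm m r =>
      rw [restr_weight_term_mul]
      exact Ideal.mul_mem_left _ _ (hx _)

/-- The exponent vectors which no weight vector in `homogeneityWeights J` separates from `m`. -/
def homogeneityClass (J : Ideal (TXPoly R n)) (m : ExpVec n) : Set (ExpVec n) :=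
  {m' | ∀ u ∈ homogeneityWeights J, weightDeg u m' = weightDeg u m}

theorem mem_homogeneityClass_self (J : Ideal (TXPoly R n)) (m : ExpVec n) :
    m ∈ homogeneityClass J m := fun _ _ => rfl

theorem homogeneityClass_eq_iff {J : Ideal (TXPoly R n)} {m m' : ExpVec n} :
    homogeneityClass J m = homogeneityClass J m' ↔ m ∈ homogeneityClass J m' := by
  constructor
  · intro h
    rw [← h]
    exact mem_homogeneityClass_self J m
  · intro h
    ext a
    exact ⟨fun ha u hu => (ha u hu).trans (h u hu), fun ha u hu => (ha u hu).trans (h u hu).symm⟩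

/-- A class is cut out by infinitely many weights, but within the finite support of `h` finitely
many suffice: one for each exponent to be excluded. -/
theorem restr_homogeneityClass_mem {J : Ideal (TXPoly R n)} {h : TXPoly R n} (hh : h ∈ J)
    (m : ExpVec n) : restr (homogeneityClass J m) h ∈ J := by
  classical
  have key : ∀ T : Finset (ℝ × (Fin n → ℝ)), (∀ u ∈ T, u ∈ homogeneityWeights J) →
      restr {m' | ∀ u ∈ T, weightDeg u m' = weightDeg u m} h ∈ J := by
    intro T
    induction T using Finset.induction_on with
    | empty =>
      intro _
      rw [restr_eq_self_of_forall]
      · exact hh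
      · intro m' _ u hu
        simp at hu
    | insert a T _ ih =>
      intro hT
      have := hT a (Finset.mem_insert_self a T) _
        (ih fun u hu => hT u (Finset.mem_insert_of_mem hu)) (weightDeg a m)
      rw [restr_restr] at this
      convert this using 2
      ext m'
      simp
  -- Exponents inside the class need no separation; for them the zero weight serves, for which every
  -- ideal is homogeneous.
  have hch : ∀ m' : ExpVec n, ∃ u ∈ homogeneityWeights J,
      m' ∉ homogeneityClass J m → weightDeg u m' ≠ weightDeg u m := by
    intro m'
    by_cases hm' : m' ∈ homogeneityClass J m
    · refine ⟨0, ?_, fun h => absurd hm' h⟩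
      intro g hg c
      by_cases hc : c = 0
      · rw [restr_eq_self_of_forall]
        · exact hg
        · intro m _
          simp [weightDeg, hc]
      · rw [restr_eq_zero_of_forall]
        · exact J.zero_mem
        · intro m _ h
          simp only [weightDeg, Set.mem_ofPred_eq] at h
          exact hc (by simpa using h.symm)
    · simp only [homogeneityClass, Set.mem_ofPred_eq, not_forall] at hm'
      obtain ⟨u, hu, hne⟩ := hm'
      exact ⟨u, hu, fun _ => hne⟩
  choose u hu hne using hch
  have := key ((finite_coeffP_support h).toFinset.image u) (by
    intro v hv
    obtain ⟨m', -, rfl⟩ := Finset.mem_image.1 hv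
    exact hu m')
  convert this using 1
  refine coeffP_ext fun m' => ?_
  rw [coeffP_restr, coeffP_restr]
  by_cases hm' : m' ∈ homogeneityClass J m
  · rw [if_pos hm', if_pos]
    intro v hv
    obtain ⟨m'', -, rfl⟩ := Finset.mem_image.1 hv
    exact hm' _ (hu m'')
  · rw [if_neg hm']
    split_ifs with h1
    · by_contra hc
      exact hne m' hm' (h1 _ (Finset.mem_image_of_mem u (by simpa using Ne.symm hc)))
    · rfl

/-- An ideal is generated by finitely many elements, each supported on a single class. -/
theorem exists_finset_span_homogeneous [IsNoetherianRing R] (J : Ideal (TXPoly R n)) :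
    ∃ G : Finset (TXPoly R n), Ideal.span (G : Set (TXPoly R n)) = J ∧ ∀ g ∈ G, g ≠ 0 ∧
      ∀ m m', coeffP g m ≠ 0 → coeffP g m' ≠ 0 → m' ∈ homogeneityClass J m := by
  classical
  obtain ⟨G₀, hG₀⟩ := (isNoetherianRing_iff_ideal_fg (TXPoly R n)).1 inferInstance J
  -- All class parts of a finite generating set; zero is dropped so that each generator has a
  -- leading exponent.
  let G : Finset (TXPoly R n) := (G₀.biUnion fun g =>
    (finite_coeffP_support g).toFinset.image fun m => restr (homogeneityClass J m) g).erase 0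
  refine ⟨G, le_antisymm ?_ ?_, ?_⟩
  · rw [Ideal.span_le]
    intro g hg
    simp only [G, Finset.coe_erase, Set.mem_sdiff, Finset.mem_coe, Finset.mem_biUnion,
      Finset.mem_image] at hg
    obtain ⟨⟨g₀, hg₀, m, -, rfl⟩, -⟩ := hg
    exact restr_homogeneityClass_mem (hG₀ ▸ Ideal.subset_span hg₀) m
  · rw [← hG₀, Submodule.span_le]
    intro g₀ hg₀
    refine mem_of_forall_restr_fiber_mem (homogeneityClass J) fun x => ?_
    by_cases hx : ∃ m, coeffP g₀ m ≠ 0 ∧ homogeneityClass J m = x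
    · obtain ⟨m, hm, rfl⟩ := hx
      have hset : {m' | homogeneityClass J m' = homogeneityClass J m} = homogeneityClass J m := by
        ext m'
        exact homogeneityClass_eq_iff
      rw [hset]
      refine Ideal.subset_span ?_
      simp only [G, Finset.coe_erase, Set.mem_sdiff, Finset.mem_coe, Finset.mem_biUnion,
        Finset.mem_image]
      refine ⟨⟨g₀, hg₀, m, by simpa using hm, rfl⟩, ?_⟩
      intro h0
      have := coeffP_restr_of_mem (mem_homogeneityClass_self J m) g₀
      rw [Set.mem_singleton_iff.1 h0, coeffP_zero] at this
      exact hm this.symm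
    · rw [restr_eq_zero_of_forall]
      · exact Ideal.zero_mem _
      · intro m hm hmx
        exact hx ⟨m, hm, hmx⟩
  · intro g hg
    simp only [G, Finset.mem_erase, Finset.mem_biUnion, Finset.mem_image] at hg
    obtain ⟨h0, g₀, hg₀, m₀, -, rfl⟩ := hg
    refine ⟨h0, fun m m' hm hm' => ?_⟩
    rw [coeffP_restr] at hm hm'
    have h1 : m ∈ homogeneityClass J m₀ := by by_contra h; simp [h] at hm
    have h2 : m' ∈ homogeneityClass J m₀ := by by_contra h; simp [h] at hm'
    rwa [homogeneityClass_eq_iff.2 h1]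

end Homogeneity

/-! ### Lifting from the initial ideal, and its homogeneity. -/

section InitialIdeals

variable {R : Type*} [CommRing R] {n : ℕ} {I : Ideal (XSeries R n)}

theorem initialForm_mem {w : ℝ × (Fin n → ℝ)} {f : XSeries R n} (hf : f ∈ I) :
    initialForm w f ∈ initialIdeal w I :=
  Ideal.subset_span (Set.mem_image_of_mem _ hf)

/-- To bound the initial ideal of an `x`-homogeneous ideal, it suffices to consider
`x`-homogeneous elements. -/
theorem initialIdeal_le (hI : IsXHomogeneous I) {w : ℝ × (Fin n → ℝ)} (hw : w.1 < 0)
    {J : Ideal (TXPoly R n)}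
    (h : ∀ f ∈ I, ∀ d : ℕ, f.IsHomogeneous d → f ≠ 0 → initialForm w f ∈ J) :
    initialIdeal w I ≤ J := by
  classical
  refine Ideal.span_le.2 ?_
  rintro _ ⟨f, hf, rfl⟩
  by_cases hf0 : f = 0
  · rw [hf0, initialForm_zero]
    exact J.zero_mem
  obtain ⟨c, hc, hc'⟩ := exists_top_weight hw hf0
  refine mem_of_forall_restr_fiber_mem (fun m : ExpVec n => m.2.degree) fun d => ?_
  -- If the initial form has a term of degree `d`, its degree-`d` part is the initial form of the
  -- degree-`d` component of `f`, which lies in `I`; otherwise that part is zero.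
  by_cases hd : ∃ m : ExpVec n, coeffTX f m ≠ 0 ∧ weightDeg w m = c ∧ m.2.degree = d
  · obtain ⟨m₀, h1, h2, h3⟩ := hd
    have hne : coeffTX (MvPolynomial.homogeneousComponent d f) m₀ ≠ 0 := by
      rwa [coeffTX_homogeneousComponent, if_pos h3]
    have := h _ (hI.homogeneousComponent_mem hf d) d
      (MvPolynomial.homogeneousComponent_isHomogeneous d f) (by
        intro h0; rw [h0, coeffTX_zero] at hne; exact hne rfl)
    convert this using 1
    refine coeffP_ext fun m => ?_
    rw [coeffP_restr, coeffP_initialForm_of_le hw hc hc',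
      coeffP_initialForm_of_le (c := c) hw _ ⟨m₀, hne, h2⟩, coeffTX_homogeneousComponent]
    · simp only [Set.mem_ofPred_eq]
      split_ifs <;> rfl
    · intro m hm
      rw [coeffTX_homogeneousComponent] at hm
      exact hc m (ite_ne_right_iff.1 hm).2
  · rw [restr_eq_zero_of_forall]
    · exact J.zero_mem
    · intro m hm hmd
      rw [coeffP_initialForm_of_le hw hc hc'] at hm
      obtain ⟨h1, h2⟩ := ite_ne_right_iff.1 hm
      exact hd ⟨m, h2, h1, hmd⟩

/-- Every bihomogeneous part of an element of the initial ideal lifts to an element of `I`. -/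
theorem exists_lift_of_mem_initialIdeal (hI : IsXHomogeneous I) {w : ℝ × (Fin n → ℝ)}
    (hw : w.1 < 0) {h : TXPoly R n} (hh : h ∈ initialIdeal w I) (c : ℝ) (d : ℕ) :
    ∃ f ∈ I, f.IsHomogeneous d ∧ (∀ m, coeffTX f m ≠ 0 → weightDeg w m ≤ c) ∧
      ∀ m : ExpVec n, weightDeg w m = c → m.2.degree = d → coeffTX f m = coeffP h m := by
  induction hh using Submodule.span_induction generalizing c d with
  | mem g hg =>
    obtain ⟨f, hf, rfl⟩ := hg
    by_cases hf0 : f = 0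
    · exact ⟨0, I.zero_mem, MvPolynomial.isHomogeneous_zero _ _ _, by simp,
        by simp [hf0, initialForm_zero]⟩
    obtain ⟨c₀, hc, hc'⟩ := exists_top_weight hw hf0
    by_cases hcc : c = c₀
    · subst hcc
      refine ⟨_, hI.homogeneousComponent_mem hf d,
        MvPolynomial.homogeneousComponent_isHomogeneous d f, ?_, ?_⟩
      · intro m hm
        rw [coeffTX_homogeneousComponent] at hm
        exact hc m (ite_ne_right_iff.1 hm).2
      · intro m hmc hmd
        rw [coeffTX_homogeneousComponent, if_pos hmd, coeffP_initialForm_of_le hw hc hc',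
          if_pos hmc]
    · refine ⟨0, I.zero_mem, MvPolynomial.isHomogeneous_zero _ _ _, by simp, ?_⟩
      intro m hm _
      rw [coeffP_initialForm_of_le hw hc hc', if_neg (by rw [hm]; exact hcc), coeffTX_zero]
  | zero => exact ⟨0, I.zero_mem, MvPolynomial.isHomogeneous_zero _ _ _, by simp, by simp⟩
  | add x y _ _ hx hy =>
    obtain ⟨f, hf, hfd, hf1, hf2⟩ := hx c d
    obtain ⟨g, hg, hgd, hg1, hg2⟩ := hy c d
    refine ⟨f + g, I.add_mem hf hg, hfd.add hgd, ?_, ?_⟩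
    · intro m hm
      rw [coeffTX_add] at hm
      by_cases h0 : coeffTX f m = 0
      · exact hg1 m (by simpa [h0] using hm)
      · exact hf1 m h0
    · intro m hm hmd
      rw [coeffTX_add, coeffP_add, hf2 m hm hmd, hg2 m hm hmd]
  | smul a x _ hx =>
    rw [smul_eq_mul]
    induction a using term_induction generalizing c d with
    | h0 => exact ⟨0, I.zero_mem, MvPolynomial.isHomogeneous_zero _ _ _, by simp, by simp⟩
    | hadd a b ha hb =>
      obtain ⟨f, hf, hfd, hf1, hf2⟩ := ha c d
      obtain ⟨g, hg, hgd, hg1, hg2⟩ := hb c d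
      refine ⟨f + g, I.add_mem hf hg, hfd.add hgd, ?_, ?_⟩
      · intro m hm
        rw [coeffTX_add] at hm
        by_cases h0 : coeffTX f m = 0
        · exact hg1 m (by simpa [h0] using hm)
        · exact hf1 m h0
      · intro m hm hmd
        rw [add_mul, coeffTX_add, coeffP_add, hf2 m hm hmd, hg2 m hm hmd]
    | hterm m₀ r =>
      -- The lift is sought in degree `d - m₀.2.degree`, a natural subtraction. If it truncates, no
      -- multiple of the term has degree `d`, and zero is a lift.
      by_cases hd : m₀.2.degree ≤ d
      · obtain ⟨f, hf, hfd, hf1, hf2⟩ := hx (c - weightDeg w m₀) (d - m₀.2.degree)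
        refine ⟨toSeries (term m₀ r) * f, I.mul_mem_left _ hf, ?_, ?_, ?_⟩
        · rw [isHomogeneous_iff_coeffTX] at hfd ⊢
          intro m hm
          obtain ⟨b, rfl, hb⟩ := exists_of_coeffTX_term_mul_ne_zero hm
          rw [Prod.snd_add, map_add, hfd b hb]
          omega
        · intro m hm
          obtain ⟨b, rfl, hb⟩ := exists_of_coeffTX_term_mul_ne_zero hm
          have := hf1 b hb
          rw [weightDeg_add]
          linarith
        · intro m hmc hmd
          rw [← coeffTX_toSeries, map_mul]
          by_cases hm : ∃ b, m = m₀ + b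
          · obtain ⟨b, rfl⟩ := hm
            rw [Prod.snd_add, map_add] at hmd
            rw [weightDeg_add] at hmc
            rw [coeffTX_term_mul, coeffTX_term_mul, coeffTX_toSeries,
              hf2 b (by linarith) (by omega)]
          · have key : ∀ g : XSeries R n, coeffTX (toSeries (term m₀ r) * g) m = 0 := fun g => by
              by_contra hne
              obtain ⟨b, hb, -⟩ := exists_of_coeffTX_term_mul_ne_zero hne
              exact hm ⟨b, hb⟩
            rw [key, key]
      · refine ⟨0, I.zero_mem, MvPolynomial.isHomogeneous_zero _ _ _, by simp, ?_⟩
        intro m hmc hmd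
        rw [coeffTX_zero, ← coeffTX_toSeries, map_mul]
        by_contra hne
        obtain ⟨b, rfl, -⟩ := exists_of_coeffTX_term_mul_ne_zero (Ne.symm hne)
        rw [Prod.snd_add, map_add] at hmd
        omega

/-- The lift of the bihomogeneous part either reaches weight `c`, and then has this part as its
initial form, or the part is zero. -/
theorem restr_mem_initialIdeal (hI : IsXHomogeneous I) {w : ℝ × (Fin n → ℝ)} (hw : w.1 < 0)
    {h : TXPoly R n} (hh : h ∈ initialIdeal w I) (c : ℝ) (d : ℕ) :
    restr {m | weightDeg w m = c ∧ m.2.degree = d} h ∈ initialIdeal w I := by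
  classical
  obtain ⟨f, hf, hfd, hf1, hf2⟩ := exists_lift_of_mem_initialIdeal hI hw hh c d
  by_cases hne : ∃ m, coeffTX f m ≠ 0 ∧ weightDeg w m = c
  · convert initialForm_mem (w := w) hf using 1
    refine coeffP_ext fun m => ?_
    rw [coeffP_initialForm_of_le hw hf1 hne, coeffP_restr]
    by_cases h1 : weightDeg w m = c
    · by_cases h2 : m.2.degree = d
      · simp [h1, h2, hf2 m h1 h2]
      · have : coeffTX f m = 0 := by
          by_contra h3
          exact h2 (isHomogeneous_iff_coeffTX.1 hfd m h3)
        simp [h1, h2, this]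
    · simp [h1]
  · rw [restr_eq_zero_of_forall]
    · exact Ideal.zero_mem _
    · rintro m hm ⟨h1, h2⟩
      exact hne ⟨m, by rwa [hf2 m h1 h2], h1⟩

theorem mem_homogeneityWeights_initialIdeal (hI : IsXHomogeneous I) {w : ℝ × (Fin n → ℝ)}
    (hw : w.1 < 0) : w ∈ homogeneityWeights (initialIdeal w I) := by
  intro h hh c
  refine mem_of_forall_restr_fiber_mem (fun m : ExpVec n => m.2.degree) fun d => ?_
  rw [restr_restr]
  convert restr_mem_initialIdeal hI hw hh c d using 2
  ext m
  exact and_comm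

theorem xDegWeight_mem_homogeneityWeights_initialIdeal (hI : IsXHomogeneous I)
    {w : ℝ × (Fin n → ℝ)} (hw : w.1 < 0) :
    xDegWeight n ∈ homogeneityWeights (initialIdeal w I) := by
  intro h hh c
  refine mem_of_forall_restr_fiber_mem (weightDeg w) fun e => ?_
  rw [restr_restr]
  by_cases hc : ∃ d : ℕ, (d : ℝ) = c
  · obtain ⟨d, rfl⟩ := hc
    convert restr_mem_initialIdeal hI hw hh e d using 2
    ext m
    simp [weightDeg_xDegWeight]
  · rw [restr_eq_zero_of_forall]
    · exact Ideal.zero_mem _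
    · rintro m - ⟨-, h2⟩
      rw [Set.mem_ofPred_eq, weightDeg_xDegWeight] at h2
      exact hc ⟨_, h2⟩

end InitialIdeals

/-! ### Division with remainder by homogeneity classes. -/

section Reduction

variable {R : Type*} [CommRing R] {n : ℕ}

/-- `F` lifts each element `g` of the finite generating set `G` of `J` to a series whose part of
top `p`-weight is `g`; the elements of `G` are supported on a single homogeneity class, that
of `a g`. -/
structure IsLiftSystem (J : Ideal (TXPoly R n)) (p : ℝ × (Fin n → ℝ)) (G : Finset (TXPoly R n))
    (F : TXPoly R n → XSeries R n) (a : TXPoly R n → ExpVec n) : Prop where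
  span_eq : Ideal.span (G : Set (TXPoly R n)) = J
  neg : p.1 < 0
  weight_mem : p ∈ homogeneityWeights J
  deg_mem : xDegWeight n ∈ homogeneityWeights J
  coeff_lead : ∀ g ∈ G, coeffP g (a g) ≠ 0
  mem_class : ∀ g ∈ G, ∀ m, coeffP g m ≠ 0 → m ∈ homogeneityClass J (a g)
  degree_eq : ∀ g ∈ G, ∀ m, coeffTX (F g) m ≠ 0 → m.2.degree = (a g).2.degree
  lower : ∀ g ∈ G, ∀ m, coeffTX (F g) m ≠ coeffP g m → weightDeg p m < weightDeg p (a g)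

/-- No homogeneity class of exponents of `r` contributes a nonzero element of `J`. -/
def IsReducedModulo (J : Ideal (TXPoly R n)) (r : XSeries R n) : Prop :=
  ∀ m, ∀ h ∈ J, (∀ k ∈ homogeneityClass J m, coeffP h k = coeffTX r k) →
    (∀ k ∉ homogeneityClass J m, coeffP h k = 0) → coeffTX r m = 0

theorem degree_eq_of_mem_homogeneityClass {J : Ideal (TXPoly R n)}
    (hJ : xDegWeight n ∈ homogeneityWeights J) {m m' : ExpVec n}
    (h : m' ∈ homogeneityClass J m) : m'.2.degree = m.2.degree := by
  have := h _ hJ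
  rw [weightDeg_xDegWeight, weightDeg_xDegWeight] at this
  exact_mod_cast this

/-- Both the `x`-degree and the `p`-weight are constant on a class, and `p.1 < 0` bounds the power
of `t`. -/
theorem finite_homogeneityClass {J : Ideal (TXPoly R n)} {p : ℝ × (Fin n → ℝ)} (hp : p.1 < 0)
    (hpJ : p ∈ homogeneityWeights J) (hJ : xDegWeight n ∈ homogeneityWeights J) (m : ExpVec n) :
    (homogeneityClass J m).Finite :=
  (finite_setOf_le_weightDeg hp m.2.degree (weightDeg p m)).subset fun _ hm' =>
    ⟨degree_eq_of_mem_homogeneityClass hJ hm', (hm' p hpJ).ge⟩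

theorem add_mem_homogeneityClass {J : Ideal (TXPoly R n)} {a b : ExpVec n}
    (h : b ∈ homogeneityClass J a) (x : ExpVec n) : x + b ∈ homogeneityClass J (x + a) := by
  intro u hu
  rw [weightDeg_add, weightDeg_add, h u hu]

/-- The series in `R⟦t⟧[x]` with the given coefficients in `x`-degree at most `d`. -/
noncomputable def seriesOf (d : ℕ) (c : ExpVec n → R) : XSeries R n :=
  ∑ b ∈ (Finsupp.finite_of_degree_le (σ := Fin n) d).toFinset,
    MvPolynomial.monomial b (PowerSeries.mk fun k => c (k, b))

theorem coeffTX_seriesOf (d : ℕ) (c : ExpVec n → R) (m : ExpVec n) :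
    coeffTX (seriesOf d c) m = if m.2.degree ≤ d then c m else 0 := by
  classical
  obtain ⟨k, b⟩ := m
  simp only [seriesOf, coeffTX, MvPolynomial.coeff_sum, MvPolynomial.coeff_monomial,
    Finset.sum_ite_eq', Set.Finite.mem_toFinset, Set.mem_ofPred_eq]
  split_ifs <;> simp

/-- The polynomial with the coefficients prescribed by `c` on `C`, for finite `C`. -/
noncomputable def polyOn (C : Set (ExpVec n)) (c : ExpVec n → R) : TXPoly R n :=
  polyOf (C.indicator c)

theorem coeffP_polyOn {C : Set (ExpVec n)} (hC : C.Finite) (c : ExpVec n → R) (m : ExpVec n)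
    [Decidable (m ∈ C)] : coeffP (polyOn C c) m = if m ∈ C then c m else 0 := by
  classical
  rw [polyOn, coeffP_polyOf (hC.subset (by simp))]
  simp [Set.indicator_apply]

theorem polyOn_congr {C : Set (ExpVec n)} {c c' : ExpVec n → R} (h : ∀ m ∈ C, c m = c' m) :
    polyOn C c = polyOn C c' := by
  unfold polyOn
  congr 1
  exact Set.indicator_congr h

section

variable {J : Ideal (TXPoly R n)} {p : ℝ × (Fin n → ℝ)} {G : Finset (TXPoly R n)}
  {F : TXPoly R n → XSeries R n} {a : TXPoly R n → ExpVec n}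

theorem IsLiftSystem.coeff_eq (hS : IsLiftSystem J p G F a) {g : TXPoly R n} (hg : g ∈ G)
    {m : ExpVec n} (hm : m ∈ homogeneityClass J (a g)) : coeffTX (F g) m = coeffP g m := by
  by_contra h
  exact (hS.lower g hg m h).ne (hm p hS.weight_mem)

theorem IsLiftSystem.coeff_ne_zero (hS : IsLiftSystem J p G F a) {g : TXPoly R n} (hg : g ∈ G)
    {m : ExpVec n} (hm : coeffP g m ≠ 0) : coeffTX (F g) m ≠ 0 := by
  rwa [hS.coeff_eq hg (hS.mem_class g hg m hm)]

/-- Elements of `J` supported on one class are homogeneous combinations of the generators. -/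
theorem IsLiftSystem.exists_homogeneous_combination (hS : IsLiftSystem J p G F a)
    {h : TXPoly R n} (hh : h ∈ J) {m : ExpVec n}
    (hm : ∀ k, coeffP h k ≠ 0 → k ∈ homogeneityClass J m) :
    ∃ s : TXPoly R n → TXPoly R n, ∑ g ∈ G, s g * g = h ∧
      ∀ g ∈ G, ∀ x, coeffP (s g) x ≠ 0 → x + a g ∈ homogeneityClass J m := by
  classical
  rw [← hS.span_eq] at hh
  obtain ⟨s, -, hs⟩ := Submodule.mem_span_finset.1 hh
  simp only [smul_eq_mul] at hs
  refine ⟨fun g => restr {x | x + a g ∈ homogeneityClass J m} (s g), ?_, ?_⟩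
  · have key : ∀ g ∈ G, ∀ x y : ExpVec n, coeffP g y ≠ 0 →
        (x + a g ∈ homogeneityClass J m ↔ x + y ∈ homogeneityClass J m) := by
      intro g hg x y hy
      have := homogeneityClass_eq_iff.2 (add_mem_homogeneityClass (hS.mem_class g hg y hy) x)
      rw [← homogeneityClass_eq_iff, ← homogeneityClass_eq_iff, this]
    refine coeffP_ext fun k => ?_
    simp only [coeffP_sum, coeffP_mul]
    by_cases hk : k ∈ homogeneityClass J m
    · rw [← hs, coeffP_sum]
      simp only [coeffP_mul]
      refine Finset.sum_congr rfl fun g hg => Finset.sum_congr rfl fun x hx => ?_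
      by_cases hy : coeffP g x.2 = 0
      · simp [hy]
      · rw [coeffP_restr_of_mem]
        rw [Set.mem_ofPred_eq, key g hg x.1 x.2 hy, mem_expAntidiagonal.1 hx]
        exact hk
    · have h0 : coeffP h k = 0 := by
        by_contra h0; exact hk (hm k h0)
      rw [h0]
      refine Finset.sum_eq_zero fun g hg => Finset.sum_eq_zero fun x hx => ?_
      by_cases hy : coeffP g x.2 = 0
      · simp [hy]
      · rw [coeffP_restr_of_notMem, zero_mul]
        rw [Set.mem_ofPred_eq, key g hg x.1 x.2 hy, mem_expAntidiagonal.1 hx]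
        exact hk
  · intro g hg x hx
    rw [coeffP_restr] at hx
    exact (ite_ne_right_iff.1 hx).1

open Classical in
/-- A choice of a homogeneous combination of the generators which represents `h`, if `h` is a
nonzero element of `J` supported on the class `C`. -/
noncomputable def combination (G : Finset (TXPoly R n)) (a : TXPoly R n → ExpVec n)
    (C : Set (ExpVec n)) (h : TXPoly R n) : TXPoly R n → TXPoly R n :=
  -- Zero is excluded so that it receives zero multipliers; otherwise an arbitrary syzygy could be
  -- chosen and supports would be uncontrolled.
  if H : h ≠ 0 ∧ ∃ s : TXPoly R n → TXPoly R n, ∑ g ∈ G, s g * g = h ∧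
      ∀ g ∈ G, ∀ x, coeffP (s g) x ≠ 0 → x + a g ∈ C then H.2.choose else 0

/-- The coefficients of the multipliers by which the reducible parts of `c` are removed. -/
noncomputable def multiplier (J : Ideal (TXPoly R n)) (G : Finset (TXPoly R n))
    (a : TXPoly R n → ExpVec n) (c : ExpVec n → R) (g : TXPoly R n) (x : ExpVec n) : R :=
  coeffP (combination G a (homogeneityClass J (x + a g))
    (polyOn (homogeneityClass J (x + a g)) c) g) x

theorem multiplier_congr {c c' : ExpVec n → R} {g : TXPoly R n} {x : ExpVec n}
    (h : ∀ m ∈ homogeneityClass J (x + a g), c m = c' m) :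
    multiplier J G a c g x = multiplier J G a c' g x := by
  unfold multiplier
  rw [polyOn_congr h]

theorem exists_of_multiplier_ne_zero {c : ExpVec n → R} {g : TXPoly R n}
    {x : ExpVec n} (h : multiplier J G a c g x ≠ 0) :
    ∃ k ∈ homogeneityClass J (x + a g), c k ≠ 0 := by
  by_contra! h'
  have h1 : polyOn (homogeneityClass J (x + a g)) c = 0 := by
    rw [polyOn_congr (c' := 0) h']
    simp [polyOn, polyOf, term]
  refine h ?_
  unfold multiplier combination
  rw [dif_neg (fun h2 => h2.1 h1)]
  simp

-- If `x + y = k` and `y` occurs in `g`, then `x + a g` is in the class of `k`. So all multipliers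
-- contributing to `k` come from the one combination chosen for that class, which reproduces the
-- class part of `c` when it lies in `J` and vanishes otherwise.
open Classical in
theorem IsLiftSystem.sum_multiplier_mul (hS : IsLiftSystem J p G F a) (c : ExpVec n → R)
    (k : ExpVec n) :
    ∑ g ∈ G, ∑ x ∈ expAntidiagonal k, multiplier J G a c g x.1 * coeffP g x.2 =
      if polyOn (homogeneityClass J k) c ∈ J then c k else 0 := by
  have hfin := finite_homogeneityClass hS.neg hS.weight_mem hS.deg_mem k
  have key : ∑ g ∈ G, ∑ x ∈ expAntidiagonal k, multiplier J G a c g x.1 * coeffP g x.2 =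
      coeffP (∑ g ∈ G, combination G a (homogeneityClass J k)
        (polyOn (homogeneityClass J k) c) g * g) k := by
    rw [coeffP_sum]
    simp only [coeffP_mul]
    refine Finset.sum_congr rfl fun g hg => Finset.sum_congr rfl fun x hx => ?_
    by_cases hy : coeffP g x.2 = 0
    · simp [hy]
    · have := homogeneityClass_eq_iff.2 (add_mem_homogeneityClass (hS.mem_class g hg x.2 hy) x.1)
      rw [mem_expAntidiagonal.1 hx] at this
      rw [multiplier, this]
  rw [key]
  have hsupp : ∀ l, coeffP (polyOn (homogeneityClass J k) c) l ≠ 0 → l ∈ homogeneityClass J k := by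
    intro l hl
    rw [coeffP_polyOn hfin] at hl
    exact (ite_ne_right_iff.1 hl).1
  split_ifs with hJ
  · by_cases h0 : polyOn (homogeneityClass J k) c = 0
    · have hck : c k = 0 := by
        have := coeffP_polyOn hfin c k
        rw [h0, if_pos (mem_homogeneityClass_self J k), coeffP_zero] at this
        exact this.symm
      unfold combination
      rw [dif_neg (fun h => h.1 h0)]
      simp [hck]
    · have hex := hS.exists_homogeneous_combination hJ hsupp
      unfold combination
      rw [dif_pos ⟨h0, hex⟩, (Exists.choose_spec (And.right ⟨h0, hex⟩)).1, coeffP_polyOn hfin,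
        if_pos (mem_homogeneityClass_self J k)]
  · unfold combination
    rw [dif_neg]
    · simp
    · rintro ⟨-, s, hs, -⟩
      refine hJ (hs ▸ J.sum_mem fun g hg => J.mul_mem_left _ ?_)
      rw [← hS.span_eq]
      exact Ideal.subset_span hg

/-- The correction which the removal of the reducible parts of `c` induces in lower weight. -/
noncomputable def correction (J : Ideal (TXPoly R n)) (G : Finset (TXPoly R n))
    (F : TXPoly R n → XSeries R n) (a : TXPoly R n → ExpVec n) (c : ExpVec n → R)
    (k : ExpVec n) : R :=
  ∑ g ∈ G, ∑ x ∈ expAntidiagonal k,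
    multiplier J G a c g x.1 * (coeffTX (F g) x.2 - coeffP g x.2)

/-- The order in which the coefficients are determined: by decreasing `p`-weight. -/
def precedes (p : ℝ × (Fin n → ℝ)) (m' m : ExpVec n) : Prop :=
  m'.2.degree = m.2.degree ∧ weightDeg p m < weightDeg p m'

/-- Only finitely many exponents of the same `x`-degree have larger `p`-weight, and their number
drops along the relation. -/
theorem wellFounded_precedes (hp : p.1 < 0) : WellFounded (precedes p) := by
  have hfin : ∀ m : ExpVec n, {m' | precedes p m' m}.Finite := fun m =>
    (finite_setOf_le_weightDeg hp m.2.degree (weightDeg p m)).subset fun m' hm' =>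
      ⟨hm'.1, hm'.2.le⟩
  refine Subrelation.wf (r := InvImage (· < ·) fun m => {m' | precedes p m' m}.ncard) ?_
    (InvImage.wf _ wellFounded_lt)
  intro m' m h
  refine Set.ncard_lt_ncard ?_ (hfin m)
  refine ⟨fun k hk => ⟨hk.1.trans h.1, h.2.trans hk.2⟩, fun hsub => ?_⟩
  exact lt_irrefl _ (hsub h).2

/-- The tail of `F g` has strictly lower `p`-weight than `g`, so removing a class only disturbs
coefficients that come later. -/
theorem IsLiftSystem.precedes_of_ne (hS : IsLiftSystem J p G F a) {g : TXPoly R n} (hg : g ∈ G)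
    {x y k : ExpVec n} (hy : coeffTX (F g) y ≠ coeffP g y) (hk : k ∈ homogeneityClass J (x + a g)) :
    precedes p k (x + y) := by
  have hy' : coeffTX (F g) y ≠ 0 := by
    intro h0
    exact hS.coeff_ne_zero hg (fun h1 => hy (h0.trans h1.symm)) h0
  refine ⟨?_, ?_⟩
  · rw [degree_eq_of_mem_homogeneityClass hS.deg_mem hk, Prod.snd_add, Prod.snd_add, map_add,
      map_add, hS.degree_eq g hg y hy']
  · rw [hk p hS.weight_mem, weightDeg_add, weightDeg_add]
    exact add_lt_add_right (hS.lower g hg y hy) _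

theorem IsLiftSystem.correction_congr (hS : IsLiftSystem J p G F a) {c c' : ExpVec n → R}
    {k : ExpVec n} (h : ∀ m, precedes p m k → c m = c' m) :
    correction J G F a c k = correction J G F a c' k := by
  refine Finset.sum_congr rfl fun g hg => Finset.sum_congr rfl fun x hx => ?_
  by_cases hy : coeffTX (F g) x.2 = coeffP g x.2
  · simp [hy]
  · rw [multiplier_congr fun m hm => h m ?_]
    have := hS.precedes_of_ne hg hy hm
    rwa [mem_expAntidiagonal.1 hx] at this

/-- The coefficients of `c` are those met when each class is treated, after all corrections from
higher weight. The correction at `k` involves only earlier values, so well-founded recursion solves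
the equation; the padding by zero is never seen. -/
theorem IsLiftSystem.exists_fixedPoint (hS : IsLiftSystem J p G F a) (f : ExpVec n → R) :
    ∃ c : ExpVec n → R, ∀ k, c k = f k - correction J G F a c k := by
  classical
  have hwf := wellFounded_precedes (n := n) hS.neg
  let step : ∀ k : ExpVec n, (∀ m, precedes p m k → R) → R := fun k IH =>
    f k - correction J G F a (fun m => if h : precedes p m k then IH m h else 0) k
  refine ⟨hwf.fix step, fun k => ?_⟩
  rw [WellFounded.fix_eq]
  simp only [step]
  congr 1
  refine hS.correction_congr fun m hm => ?_
  rw [dif_pos hm]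

/-- Division with remainder: every homogeneous series is a combination of the lifts `F g` up to a
reduced remainder, and the exponents which occur can be controlled. -/
theorem IsLiftSystem.exists_reduction (hS : IsLiftSystem J p G F a) {f : XSeries R n} {d : ℕ}
    (hf : f.IsHomogeneous d) :
    ∃ (q : TXPoly R n → XSeries R n) (r : XSeries R n), f = ∑ g ∈ G, q g * F g + r ∧
      IsReducedModulo J r ∧ r.IsHomogeneous d ∧
      ∀ B : Set (ExpVec n), (∀ m, coeffTX f m ≠ 0 → m ∈ B) →
        (∀ k ∈ B, ∀ g ∈ G, ∀ x y, x + a g ∈ homogeneityClass J k → coeffTX (F g) y ≠ 0 →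
          x + y ∈ B) →
        (∀ m, coeffTX r m ≠ 0 → m ∈ B) ∧
        ∀ g ∈ G, ∀ x, coeffTX (q g) x ≠ 0 → ∃ k ∈ B, x + a g ∈ homogeneityClass J k := by
  classical
  obtain ⟨c, hc⟩ := hS.exists_fixedPoint (coeffTX f)
  -- A set of exponents that contains the support of `f` and is stable under replacing a generator
  -- by its lift contains everything the recursion touches.
  have hcB : ∀ B : Set (ExpVec n), (∀ m, coeffTX f m ≠ 0 → m ∈ B) →
      (∀ k ∈ B, ∀ g ∈ G, ∀ x y, x + a g ∈ homogeneityClass J k → coeffTX (F g) y ≠ 0 →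
        x + y ∈ B) → ∀ k, c k ≠ 0 → k ∈ B := by
    intro B hB1 hB2 k
    induction k using (wellFounded_precedes (n := n) hS.neg).induction with
    | h k ih =>
      intro hk
      by_cases h0 : coeffTX f k = 0
      · rw [hc k, h0, zero_sub, neg_ne_zero] at hk
        obtain ⟨g, hg, hne⟩ := Finset.exists_ne_zero_of_sum_ne_zero hk
        obtain ⟨x, hx, hne⟩ := Finset.exists_ne_zero_of_sum_ne_zero hne
        rw [mem_expAntidiagonal] at hx
        have hy : coeffTX (F g) x.2 ≠ coeffP g x.2 := by
          intro h; rw [h, sub_self, mul_zero] at hne; exact hne rfl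
        have hy' : coeffTX (F g) x.2 ≠ 0 := by
          intro h0
          exact hS.coeff_ne_zero hg (fun h1 => hy (h0.trans h1.symm)) h0
        obtain ⟨k', hk', hck'⟩ := exists_of_multiplier_ne_zero (left_ne_zero_of_mul hne)
        have hpre := hS.precedes_of_ne hg hy hk'
        rw [hx] at hpre
        rw [← hx]
        refine hB2 k' (ih k' hpre hck') g hg _ _ ?_ hy'
        exact fun u hu => (hk' u hu).symm
      · exact hB1 k h0
  have hdeg : ∀ k, c k ≠ 0 → k.2.degree = d := by
    refine hcB {k | k.2.degree = d} (fun m hm => isHomogeneous_iff_coeffTX.1 hf m hm) ?_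
    intro k hk g hg x y hx hy
    have := degree_eq_of_mem_homogeneityClass hS.deg_mem hx
    rw [Set.mem_ofPred_eq] at hk ⊢
    rw [Prod.snd_add, map_add] at this ⊢
    rw [hS.degree_eq g hg y hy, this, hk]
  -- Truncation at degree `d` loses nothing, because `c` lives in degree `d` and a nonzero
  -- multiplier at `x` needs `x + a g` of degree `d`.
  have hq : ∀ g ∈ G, ∀ x, coeffTX (seriesOf d (multiplier J G a c g)) x =
      multiplier J G a c g x := by
    intro g hg x
    rw [coeffTX_seriesOf]
    split_ifs with hx
    · rfl
    · by_contra hne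
      obtain ⟨k, hk, hck⟩ := exists_of_multiplier_ne_zero (Ne.symm hne)
      have := degree_eq_of_mem_homogeneityClass hS.deg_mem hk
      rw [hdeg k hck, Prod.snd_add, map_add] at this
      omega
  let q : TXPoly R n → XSeries R n := fun g => seriesOf d (multiplier J G a c g)
  -- The remainder consists of exactly those class parts of `c` that do not lie in `J`.
  have hr : ∀ k, coeffTX (f - ∑ g ∈ G, q g * F g) k =
      c k - if polyOn (homogeneityClass J k) c ∈ J then c k else 0 := by
    intro k
    rw [← hS.sum_multiplier_mul, coeffTX_sub, coeffTX_sum]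
    nth_rewrite 1 [hc k]
    rw [correction, sub_sub, ← Finset.sum_add_distrib]
    congr 1
    refine Finset.sum_congr rfl fun g hg => ?_
    rw [coeffTX_mul, ← Finset.sum_add_distrib]
    refine Finset.sum_congr rfl fun x _ => ?_
    rw [hq g hg]
    ring
  have hr' : ∀ k, coeffTX (f - ∑ g ∈ G, q g * F g) k ≠ 0 → c k ≠ 0 := by
    intro k hk h0
    rw [hr, h0, ite_self, sub_zero] at hk
    exact hk rfl
  refine ⟨q, f - ∑ g ∈ G, q g * F g, by ring, ?_, ?_, ?_⟩
  · intro m h hh h1 h2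
    rw [hr]
    split_ifs with hJ
    · exact sub_self _
    · exfalso
      refine hJ ?_
      convert hh using 1
      refine coeffP_ext fun k => ?_
      rw [coeffP_polyOn (finite_homogeneityClass hS.neg hS.weight_mem hS.deg_mem m)]
      split_ifs with hk
      · rw [h1 k hk, hr, homogeneityClass_eq_iff.2 hk, if_neg hJ, sub_zero]
      · rw [h2 k hk]
  · rw [isHomogeneous_iff_coeffTX]
    exact fun m hm => hdeg m (hr' m hm)
  · intro B hB1 hB2
    refine ⟨fun m hm => hcB B hB1 hB2 m (hr' m hm), fun g hg x hx => ?_⟩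
    rw [hq g hg] at hx
    obtain ⟨k, hk, hck⟩ := exists_of_multiplier_ne_zero hx
    exact ⟨k, hcB B hB1 hB2 k hck, fun u hu => (hk u hu).symm⟩

end

end Reduction

/-! ### Initial ideals from lifts, and reduced lifts. -/

section ReducedSystems

variable {R : Type*} [CommRing R] {n : ℕ} {J : Ideal (TXPoly R n)} {p : ℝ × (Fin n → ℝ)}
  {G : Finset (TXPoly R n)} {F : TXPoly R n → XSeries R n} {a : TXPoly R n → ExpVec n}

/-- The weight `v` is constant on classes, so the initial form consists of whole class parts of `r`.
If it were in `J`, so would be these nonzero parts. -/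
theorem IsReducedModulo.initialForm_notMem {r : XSeries R n} (hr : IsReducedModulo J r)
    (hr0 : r ≠ 0) {v : ℝ × (Fin n → ℝ)} (hv : v.1 < 0) (hvJ : v ∈ homogeneityWeights J) :
    initialForm v r ∉ J := by
  classical
  intro hmem
  obtain ⟨c, hc, m, hm, hmc⟩ := exists_top_weight hv hr0
  refine hm (hr m _ (restr_homogeneityClass_mem hmem m) ?_ ?_)
  · intro k hk
    rw [coeffP_restr_of_mem hk, coeffP_initialForm_of_le hv hc ⟨m, hm, hmc⟩, if_pos]
    rw [hk v hvJ, hmc]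
  · intro k hk
    exact coeffP_restr_of_notMem hk _

theorem IsLiftSystem.weightDeg_le (hS : IsLiftSystem J p G F a) {g : TXPoly R n} (hg : g ∈ G)
    {m : ExpVec n} (hm : coeffTX (F g) m ≠ 0) : weightDeg p m ≤ weightDeg p (a g) := by
  by_cases h : coeffTX (F g) m = coeffP g m
  · exact (hS.mem_class g hg m (h ▸ hm) p hS.weight_mem).le
  · exact (hS.lower g hg m h).le

theorem IsLiftSystem.initialForm_eq (hS : IsLiftSystem J p G F a) {g : TXPoly R n} (hg : g ∈ G) :
    initialForm p (F g) = g := by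
  refine coeffP_ext fun m => ?_
  rw [coeffP_initialForm_of_le hS.neg (fun m => hS.weightDeg_le hg)
    ⟨a g, hS.coeff_ne_zero hg (hS.coeff_lead g hg), rfl⟩]
  split_ifs with h
  · by_contra hne
    exact (hS.lower g hg m hne).ne h
  · by_contra hne
    exact h (hS.mem_class g hg m (Ne.symm hne) p hS.weight_mem)

/-- If `F` lifts generators of `J` into `I` and no nonzero reduced series lies in `I`, then the
initial ideal for a weight `v` is generated by the initial forms of the lifts as soon as each
initial form of a lift involves the corresponding generator. -/
theorem IsLiftSystem.initialIdeal_eq_span (hS : IsLiftSystem J p G F a) {I : Ideal (XSeries R n)}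
    (hI : IsXHomogeneous I) (hF : ∀ g ∈ G, F g ∈ I)
    (hred : ∀ r ∈ I, ∀ d : ℕ, r.IsHomogeneous d → IsReducedModulo J r → r = 0)
    {v : ℝ × (Fin n → ℝ)} (hv : v.1 < 0) (hvJ : v ∈ homogeneityWeights J)
    (hle : ∀ g ∈ G, ∀ m, coeffTX (F g) m ≠ 0 → weightDeg v m ≤ weightDeg v (a g)) :
    initialIdeal v I = Ideal.span ((fun g => initialForm v (F g)) '' (G : Set (TXPoly R n))) := by
  classical
  refine le_antisymm (initialIdeal_le hI hv fun f hf d hfd hf0 => ?_) ?_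
  swap
  · refine Ideal.span_le.2 ?_
    rintro _ ⟨g, hg, rfl⟩
    exact initialForm_mem (hF g hg)
  obtain ⟨c, hc, hc'⟩ := exists_top_weight hv hf0
  obtain ⟨q, r, hqr, hr, hrd, hB⟩ := hS.exists_reduction hfd
  have hr0 : r = 0 := by
    refine hred r ?_ d hrd hr
    rw [← sub_eq_of_eq_add' hqr]
    exact I.sub_mem hf (I.sum_mem fun g hg => I.mul_mem_left _ (hF g hg))
  rw [hr0, add_zero] at hqr
  -- The bound `v`-weight at most `c` is stable under the reduction, so no product `q g * F g`
  -- exceeds the weight of `f` and no cancellation occurs above it.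
  obtain ⟨-, hq⟩ := hB {m | m.2.degree = d ∧ weightDeg v m ≤ c}
    (fun m hm => ⟨isHomogeneous_iff_coeffTX.1 hfd m hm, hc m hm⟩) (by
      rintro k ⟨hk1, hk2⟩ g hg x y hx hy
      have h1 := degree_eq_of_mem_homogeneityClass hS.deg_mem hx
      have h2 := hx v hvJ
      have h3 := hle g hg y hy
      have h4 := hS.degree_eq g hg y hy
      rw [Prod.snd_add, map_add] at h1
      rw [weightDeg_add] at h2
      refine ⟨?_, ?_⟩
      · rw [Prod.snd_add, map_add, h4, h1, hk1]
      · rw [weightDeg_add]; linarith)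
  -- The exponents of `q g` that contribute to weight `c`; their part of `q g` is the coefficient of
  -- the initial form of `F g`.
  let C : TXPoly R n → Set (ExpVec n) := fun g =>
    {x | x.2.degree + (a g).2.degree = d ∧ weightDeg v x + weightDeg v (a g) = c}
  have hC : ∀ g, (C g).Finite := fun g =>
    (finite_setOf_le_weightDeg hv (d - (a g).2.degree) (c - weightDeg v (a g))).subset
      fun x hx => ⟨by have := hx.1; omega, by have := hx.2; linarith⟩
  have hqx : ∀ g ∈ G, ∀ x, coeffTX (q g) x ≠ 0 →
      x.2.degree + (a g).2.degree = d ∧ weightDeg v x + weightDeg v (a g) ≤ c := by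
    intro g hg x hx
    obtain ⟨k, ⟨hk1, hk2⟩, hk⟩ := hq g hg x hx
    have h1 := degree_eq_of_mem_homogeneityClass hS.deg_mem hk
    have h2 := hk v hvJ
    rw [Prod.snd_add, map_add] at h1
    rw [weightDeg_add] at h2
    exact ⟨h1.trans hk1, h2.le.trans hk2⟩
  have hsum : initialForm v f = ∑ g ∈ G, polyOn (C g) (coeffTX (q g)) * initialForm v (F g) := by
    refine coeffP_ext fun k => ?_
    rw [coeffP_initialForm_of_le hv hc hc', coeffP_sum]
    have hin : ∀ g ∈ G, ∀ y, coeffP (initialForm v (F g)) y =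
        if weightDeg v y = weightDeg v (a g) then coeffTX (F g) y else 0 := fun g hg y =>
      coeffP_initialForm_of_le hv (hle g hg)
        ⟨a g, hS.coeff_ne_zero hg (hS.coeff_lead g hg), rfl⟩ y
    simp only [coeffP_mul]
    split_ifs with hk
    · nth_rewrite 1 [hqr]
      rw [coeffTX_sum]
      refine Finset.sum_congr rfl fun g hg => ?_
      rw [coeffTX_mul]
      refine Finset.sum_congr rfl fun x hx => ?_
      rw [hin g hg, coeffP_polyOn (hC g)]
      by_cases h1 : coeffTX (q g) x.1 = 0
      · simp [h1]
      by_cases h2 : coeffTX (F g) x.2 = 0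
      · simp [h2]
      have h3 := hqx g hg x.1 h1
      have h4 := hle g hg x.2 h2
      rw [← mem_expAntidiagonal.1 hx, weightDeg_add] at hk
      rw [if_pos, if_pos (by linarith)]
      exact ⟨h3.1, by linarith⟩
    · refine (Finset.sum_eq_zero fun g hg => Finset.sum_eq_zero fun x hx => ?_).symm
      rw [hin g hg, coeffP_polyOn (hC g)]
      split_ifs with h1 h2
      · exfalso
        refine hk ?_
        rw [← mem_expAntidiagonal.1 hx, weightDeg_add, h2]
        exact h1.2
      · simp
      · simp
      · simp
  rw [hsum]
  exact Ideal.sum_mem _ fun g hg => Ideal.mul_mem_left _ _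
    (Ideal.subset_span (Set.mem_image_of_mem _ hg))

/-- If each `g` is an initial form for `v`, then `J` is generated by `v`-homogeneous elements, so
`v` is a homogeneity weight and the previous generation statement applies. -/
theorem IsLiftSystem.initialIdeal_eq (hS : IsLiftSystem J p G F a) {I : Ideal (XSeries R n)}
    (hI : IsXHomogeneous I) (hF : ∀ g ∈ G, F g ∈ I)
    (hred : ∀ r ∈ I, ∀ d : ℕ, r.IsHomogeneous d → IsReducedModulo J r → r = 0)
    {v : ℝ × (Fin n → ℝ)} (hv : v.1 < 0) (hvg : ∀ g ∈ G, initialForm v (F g) = g) :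
    initialIdeal v I = J := by
  classical
  have hmax : ∀ g ∈ G, ∀ m, coeffP g m ≠ 0 → m ∈ maxExponents v (F g) := by
    intro g hg m hm
    rw [← hvg g hg, coeffP_initialForm hv] at hm
    exact (ite_ne_right_iff.1 hm).1
  rw [hS.initialIdeal_eq_span hI hF hred hv]
  · rw [← hS.span_eq]
    congr 1
    ext h
    constructor
    · rintro ⟨g, hg, rfl⟩
      simpa only [hvg g hg] using hg
    · intro hh
      exact ⟨h, hh, hvg h hh⟩
  · rw [← hS.span_eq]
    refine mem_homogeneityWeights_of_span fun g hg m m' hm hm' => ?_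
    have h1 := hmax g hg m hm
    have h2 := hmax g hg m' hm'
    exact le_antisymm (h2.2 _ h1.1) (h1.2 _ h2.1)
  · intro g hg m hm
    exact (hmax g hg _ (hS.coeff_lead g hg)).2 m hm

/-- Existence of reduced lifts: a lift `F g` of this kind has initial form `g` for every weight `u`
for which `J` is homogeneous and contains the initial form of `F g`. -/
theorem exists_reduced_liftSystem [IsNoetherianRing R] {I : Ideal (XSeries R n)}
    (hI : IsXHomogeneous I) (hp : p.1 < 0) (hJI : J ≤ initialIdeal p I)
    (hpJ : p ∈ homogeneityWeights J) (hdJ : xDegWeight n ∈ homogeneityWeights J) :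
    ∃ (G : Finset (TXPoly R n)) (F : TXPoly R n → XSeries R n) (a : TXPoly R n → ExpVec n),
      IsLiftSystem J p G F a ∧ (∀ g ∈ G, F g ∈ I) ∧
      ∀ g ∈ G, ∀ u ∈ homogeneityWeights J, u.1 < 0 → initialForm u (F g) ∈ J →
        initialForm u (F g) = g := by
  classical
  obtain ⟨G, hGJ, hG⟩ := exists_finset_span_homogeneous J
  have ha : ∀ g : TXPoly R n, ∃ m, g ∈ G → coeffP g m ≠ 0 := by
    intro g
    by_cases hg : g ∈ G
    · obtain ⟨m, hm⟩ := exists_coeffP_ne_zero (hG g hg).1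
      exact ⟨m, fun _ => hm⟩
    · exact ⟨0, fun h => absurd h hg⟩
  choose a ha using ha
  have hGmem : ∀ g ∈ G, g ∈ J := fun g hg => hGJ ▸ Ideal.subset_span hg
  have hF₀ : ∀ g : TXPoly R n, ∃ f : XSeries R n, g ∈ G → f ∈ I ∧
      f.IsHomogeneous (a g).2.degree ∧
      (∀ m, coeffTX f m ≠ 0 → weightDeg p m ≤ weightDeg p (a g)) ∧
      ∀ m : ExpVec n, weightDeg p m = weightDeg p (a g) → m.2.degree = (a g).2.degree →
        coeffTX f m = coeffP g m := by
    intro g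
    by_cases hg : g ∈ G
    · obtain ⟨f, h1, h2⟩ := exists_lift_of_mem_initialIdeal hI hp (hJI (hGmem g hg))
        (weightDeg p (a g)) (a g).2.degree
      exact ⟨f, fun _ => ⟨h1, h2⟩⟩
    · exact ⟨0, fun h => absurd h hg⟩
  choose F₀ hF₀ using hF₀
  have hclass : ∀ g ∈ G, ∀ m, coeffP g m ≠ 0 → m ∈ homogeneityClass J (a g) :=
    fun g hg m hm => (hG g hg).2 _ _ (ha g hg) hm
  have hS₀ : IsLiftSystem J p G F₀ a := by
    refine ⟨hGJ, hp, hpJ, hdJ, ha, hclass, ?_, ?_⟩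
    · exact fun g hg m hm => isHomogeneous_iff_coeffTX.1 (hF₀ g hg).2.1 m hm
    · intro g hg m hm
      obtain ⟨-, h2, h3, h4⟩ := hF₀ g hg
      by_cases h0 : coeffP g m = 0
      · rw [h0] at hm
        refine lt_of_le_of_ne (h3 m hm) fun he => ?_
        rw [h4 m he (isHomogeneous_iff_coeffTX.1 h2 m hm)] at hm
        exact hm h0
      · have hm' := hclass g hg m h0
        exact absurd (h4 m (hm' p hpJ) (degree_eq_of_mem_homogeneityClass hdJ hm')) hm
  have hr : ∀ g : TXPoly R n, ∃ r : XSeries R n, g ∈ G → toSeries g + r ∈ I ∧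
      IsReducedModulo J r ∧ (∀ m, coeffTX r m ≠ 0 →
        m.2.degree = (a g).2.degree ∧ weightDeg p m < weightDeg p (a g)) := by
    intro g
    by_cases hg : g ∈ G
    swap
    · exact ⟨0, fun h => absurd h hg⟩
    have hdiff : ∀ m, coeffTX (F₀ g - toSeries g) m ≠ 0 →
        m.2.degree = (a g).2.degree ∧ weightDeg p m < weightDeg p (a g) := by
      intro m hm
      rw [coeffTX_sub, coeffTX_toSeries, sub_ne_zero] at hm
      refine ⟨?_, hS₀.lower g hg m hm⟩
      by_cases h0 : coeffP g m = 0
      · rw [h0] at hm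
        exact hS₀.degree_eq g hg m hm
      · exact degree_eq_of_mem_homogeneityClass hdJ (hclass g hg m h0)
    -- Only the tail of an arbitrary lift is reduced. Its weights stay strictly below that of `g`,
    -- so `g` itself is untouched.
    obtain ⟨q, r, hqr, hr, hrd, hB⟩ := hS₀.exists_reduction (f := F₀ g - toSeries g)
      (isHomogeneous_iff_coeffTX.2 fun m hm => (hdiff m hm).1)
    refine ⟨r, fun _ => ⟨?_, hr, fun m hm => ⟨isHomogeneous_iff_coeffTX.1 hrd m hm, ?_⟩⟩⟩
    · have : toSeries g + r = F₀ g - ∑ g' ∈ G, q g' * F₀ g' := by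
        linear_combination -hqr
      rw [this]
      exact I.sub_mem (hF₀ g hg).1 (I.sum_mem fun g' hg' => I.mul_mem_left _ (hF₀ g' hg').1)
    · refine (hB {m | weightDeg p m < weightDeg p (a g)} (fun m hm => (hdiff m hm).2) ?_).1 m hm
      intro k hk g' hg' x y hx hy
      have h1 := hx p hpJ
      have h2 := hS₀.weightDeg_le hg' hy
      rw [Set.mem_ofPred_eq] at hk ⊢
      rw [weightDeg_add] at h1 ⊢
      linarith
  choose r hr using hr
  have hzero : ∀ g ∈ G, ∀ m ∈ homogeneityClass J (a g), coeffTX (r g) m = 0 := by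
    intro g hg m hm
    by_contra hne
    exact (((hr g hg).2.2 m hne).2).ne (hm p hpJ)
  refine ⟨G, fun g => toSeries g + r g, a, ⟨hGJ, hp, hpJ, hdJ, ha, hclass, ?_, ?_⟩,
    fun g hg => (hr g hg).1, ?_⟩
  · intro g hg m hm
    rw [coeffTX_add, coeffTX_toSeries] at hm
    by_cases h0 : coeffP g m = 0
    · rw [h0, zero_add] at hm
      exact ((hr g hg).2.2 m hm).1
    · exact degree_eq_of_mem_homogeneityClass hdJ (hclass g hg m h0)
  · intro g hg m hm
    rw [coeffTX_add, coeffTX_toSeries, ne_eq, add_eq_left] at hm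
    exact ((hr g hg).2.2 m hm).2
  · intro g hg u hu hu0 hmem
    have hne : toSeries g + r g ≠ 0 := by
      intro h0
      have h1 : coeffTX (toSeries g + r g) (a g) = 0 := by rw [h0, coeffTX_zero]
      rw [coeffTX_add, coeffTX_toSeries, hzero g hg _ (mem_homogeneityClass_self J _),
        add_zero] at h1
      exact ha g hg h1
    obtain ⟨c, hc, m₀, hm₀, hm₀c⟩ := exists_top_weight hu0 hne
    have hcoeff := coeffP_initialForm_of_le hu0 hc ⟨m₀, hm₀, hm₀c⟩
    -- The tail does not reach the initial form: at such an `m`, the class of `m` is not that of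
    -- `g`, so the class part of the initial form is one of `r g` and lies in `J`, contradicting
    -- reducedness.
    have hrm : ∀ m, weightDeg u m = c → coeffTX (r g) m = 0 := by
      intro m hmc
      by_contra hrm
      have hma : ∀ k ∈ homogeneityClass J m, coeffP g k = 0 := by
        intro k hk
        by_contra hgk
        refine hrm (hzero g hg m ?_)
        have h1 := homogeneityClass_eq_iff.2 hk
        have h2 := homogeneityClass_eq_iff.2 (hclass g hg k hgk)
        rw [← homogeneityClass_eq_iff, ← h1, h2]
      refine hrm ((hr g hg).2.1 m _ (restr_homogeneityClass_mem hmem m) ?_ ?_)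
      · intro k hk
        rw [coeffP_restr_of_mem hk, hcoeff, if_pos ((hk u hu).trans hmc), coeffTX_add,
          coeffTX_toSeries, hma k hk, zero_add]
      · intro k hk
        exact coeffP_restr_of_notMem hk _
    have hgm₀ : coeffP g m₀ ≠ 0 := by
      rwa [coeffTX_add, coeffTX_toSeries, hrm m₀ hm₀c, add_zero] at hm₀
    refine coeffP_ext fun m => ?_
    rw [hcoeff]
    split_ifs with hmc
    · rw [coeffTX_add, coeffTX_toSeries, hrm m hmc, add_zero]
    · by_contra hgm
      refine hmc ?_
      rw [hclass g hg m (Ne.symm hgm) u hu, ← hclass g hg m₀ hgm₀ u hu, hm₀c]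

end ReducedSystems

open Filter Topology

/-! ### The linear conditions that describe equality of initial ideals. -/

section Cells

variable {R : Type*} [CommRing R] {n : ℕ}

/-- For small `ε > 0`, the initial form for `v + ε w` is the part of top `w`-weight of the
initial form for `v`. -/
theorem eventually_coeffP_initialForm_add_smul {v w : ℝ × (Fin n → ℝ)} (hv : v.1 < 0)
    (hw : w.1 < 0) {f : XSeries R n} {κ μ : ℝ} (h1 : ∀ m, coeffTX f m ≠ 0 → weightDeg v m ≤ κ)
    (h2 : ∀ m, coeffTX f m ≠ 0 → weightDeg v m = κ → weightDeg w m ≤ μ)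
    (h3 : ∃ m, coeffTX f m ≠ 0 ∧ weightDeg v m = κ ∧ weightDeg w m = μ) :
    ∀ᶠ ε in 𝓝[>] (0 : ℝ), ∀ m, coeffP (initialForm (v + ε • w) f) m =
      if weightDeg v m = κ ∧ weightDeg w m = μ then coeffTX f m else 0 := by
  have hev : ∀ᶠ ε in 𝓝[>] (0 : ℝ), ∀ m ∈ lowExp f, weightDeg v m < κ →
      weightDeg v m + ε * weightDeg w m < κ + ε * μ := by
    rw [Filter.eventually_all_finset]
    intro m _
    by_cases hm : weightDeg v m < κ
    · have hcont : ContinuousAt (fun ε : ℝ => κ + ε * μ - (weightDeg v m + ε * weightDeg w m)) 0 := by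
        fun_prop
      have := (hcont.eventually (lt_mem_nhds (a := 0) (by simpa using hm))).filter_mono
        (nhdsWithin_le_nhds (s := Set.Ioi 0))
      filter_upwards [this] with ε hε _
      linarith
    · exact Eventually.of_forall fun ε h => absurd h hm
  filter_upwards [hev, self_mem_nhdsWithin] with ε hε (hpos : 0 < ε) m
  have hneg : (v + ε • w).1 < 0 := by
    simp only [Prod.fst_add, Prod.smul_fst, smul_eq_mul]
    nlinarith
  have hwd : ∀ m, weightDeg (v + ε • w) m = weightDeg v m + ε * weightDeg w m := fun m => by
    rw [weightDeg_add_weight, weightDeg_smul_weight]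
  have hlow : ∀ m ∈ lowExp f, weightDeg (v + ε • w) m ≤ κ + ε * μ := by
    intro m hm
    have hm0 := coeffTX_ne_zero_of_mem_lowExp hm
    rw [hwd]
    rcases (h1 m hm0).lt_or_eq with hlt | heq
    · exact (hε m hm hlt).le
    · have := h2 m hm0 heq
      rw [heq]
      nlinarith
  have hle : ∀ m, coeffTX f m ≠ 0 → weightDeg (v + ε • w) m ≤ κ + ε * μ := by
    intro m hm
    obtain ⟨m', hm', e1, e2⟩ := exists_mem_lowExp hm
    exact (weightDeg_le_of_fst_le hneg.le e1 e2).trans (hlow m' hm')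
  rw [coeffP_initialForm_of_le hneg hle (by
    obtain ⟨m, hm, e1, e2⟩ := h3
    exact ⟨m, hm, by rw [hwd, e1, e2]⟩)]
  by_cases hm : coeffTX f m = 0
  · simp [hm]
  congr 1
  rw [eq_iff_iff]
  constructor
  · intro h
    obtain ⟨m', hm', e1, e2⟩ := exists_mem_lowExp hm
    obtain rfl : m = m' := eq_of_weightDeg_le hneg e1 e2 (h ▸ hlow m' hm')
    have e3 : weightDeg v m = κ := by
      by_contra hne
      have := hε m hm' (lt_of_le_of_ne (h1 m hm) hne)
      rw [← hwd, h] at this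
      exact lt_irrefl _ this
    refine ⟨e3, ?_⟩
    rw [hwd, e3] at h
    have := add_left_cancel h
    exact mul_left_cancel₀ hpos.ne' this
  · rintro ⟨e1, e2⟩
    rw [hwd, e1, e2]

/-- A description of the set of weights which share the initial ideal of `w`, by finitely many
linear equations `Eq` and strict linear inequalities `Lt`, together with the behaviour of initial
ideals on the closed cone cut out by the weak inequalities. -/
structure IsCellDescription (I : Ideal (XSeries R n)) (w : ℝ × (Fin n → ℝ))
    (Eq Lt : Finset (StrongDual ℝ (ℝ × (Fin n → ℝ)))) : Prop where
  mem_iff : ∀ v, v.1 < 0 →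
    (initialIdeal v I = initialIdeal w I ↔ (∀ l ∈ Eq, l v = 0) ∧ ∀ l ∈ Lt, l v < 0)
  eq_of_tight : ∀ v v', v.1 < 0 → v'.1 < 0 → (∀ l ∈ Eq, l v = 0) → (∀ l ∈ Lt, l v ≤ 0) →
    (∀ l ∈ Eq, l v' = 0) → (∀ l ∈ Lt, l v' ≤ 0) → (∀ l ∈ Lt, l v = 0 ↔ l v' = 0) →
    initialIdeal v I = initialIdeal v' I
  absorb : ∀ v v', v.1 < 0 → v'.1 < 0 → (∀ l ∈ Eq, l v = 0) → (∀ l ∈ Lt, l v ≤ 0) →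
    initialIdeal v' I = initialIdeal v I → (∀ l ∈ Eq, l v' = 0) ∧ ∀ l ∈ Lt, l v' ≤ 0

-- For reduced lifts `F g`, the equations say that all exponents of `g` have equal weight, the
-- inequalities that the other low exponents of `F g` lie below. For `absorb` the principle is that
-- `in_w` of `in_v(I)` lies in `J` for `v` in the closed cone; applied to `v'`, it shows that `v' +
-- ε w` lies in the cell of `w` for small `ε > 0`.
set_option maxHeartbeats 400000 in
theorem exists_isCellDescription [IsNoetherianRing R] {I : Ideal (XSeries R n)}
    (hI : IsXHomogeneous I) {w : ℝ × (Fin n → ℝ)} (hw : w.1 < 0) :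
    ∃ Eq Lt, IsCellDescription I w Eq Lt := by
  classical
  set J := initialIdeal w I with hJ
  have hwJ : w ∈ homogeneityWeights J := mem_homogeneityWeights_initialIdeal hI hw
  have hdJ := xDegWeight_mem_homogeneityWeights_initialIdeal (I := I) hI hw
  rw [← hJ] at hdJ
  obtain ⟨G, F, a, hS, hF, hfix⟩ := exists_reduced_liftSystem hI hw hJ.le hwJ hdJ
  have hred : ∀ r ∈ I, ∀ d : ℕ, r.IsHomogeneous d → IsReducedModulo J r → r = 0 := by
    intro r hr d _ hrJ
    by_contra h0
    exact hrJ.initialForm_notMem h0 hw hwJ (initialForm_mem hr)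
  let Eq : Finset (StrongDual ℝ (ℝ × (Fin n → ℝ))) := G.biUnion fun g =>
    (finite_coeffP_support g).toFinset.image fun m => weightFunctional m - weightFunctional (a g)
  let Lt : Finset (StrongDual ℝ (ℝ × (Fin n → ℝ))) := G.biUnion fun g =>
    ((lowExp (F g)).filter fun m => coeffP g m = 0).image
      fun m => weightFunctional m - weightFunctional (a g)
  have hEq : ∀ v, (∀ l ∈ Eq, l v = 0) ↔
      ∀ g ∈ G, ∀ m, coeffP g m ≠ 0 → weightDeg v m = weightDeg v (a g) := by
    intro v
    simp only [Eq, Finset.mem_biUnion, Finset.mem_image, Set.Finite.mem_toFinset,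
      Function.mem_support]
    constructor
    · intro h g hg m hm
      have := h _ ⟨g, hg, m, hm, rfl⟩
      simpa [sub_eq_zero] using this
    · rintro h _ ⟨g, hg, m, hm, rfl⟩
      simp [h g hg m hm]
  have hLt : ∀ (P : StrongDual ℝ (ℝ × (Fin n → ℝ)) → Prop), (∀ l ∈ Lt, P l) ↔
      ∀ g ∈ G, ∀ m ∈ lowExp (F g), coeffP g m = 0 →
        P (weightFunctional m - weightFunctional (a g)) := by
    intro P
    simp only [Lt, Finset.mem_biUnion, Finset.mem_image, Finset.mem_filter]
    constructor
    · intro h g hg m hm h0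
      exact h _ ⟨g, hg, m, ⟨hm, h0⟩, rfl⟩
    · rintro h _ ⟨g, hg, m, ⟨hm, h0⟩, rfl⟩
      exact h g hg m hm h0
  have hLead : ∀ g ∈ G, coeffTX (F g) (a g) ≠ 0 := fun g hg =>
    hS.coeff_ne_zero hg (hS.coeff_lead g hg)
  have hle : ∀ v, v.1 < 0 → (∀ l ∈ Eq, l v = 0) → (∀ l ∈ Lt, l v ≤ 0) → ∀ g ∈ G, ∀ m,
      coeffTX (F g) m ≠ 0 → weightDeg v m ≤ weightDeg v (a g) ∧
        (weightDeg v m = weightDeg v (a g) → m ∈ lowExp (F g)) := by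
    intro v hv h1 h2 g hg m hm
    rw [hEq] at h1
    rw [hLt (fun l => l v ≤ 0)] at h2
    obtain ⟨m', hm', e1, e2⟩ := exists_mem_lowExp hm
    have h3 : weightDeg v m' ≤ weightDeg v (a g) := by
      by_cases h0 : coeffP g m' = 0
      · simpa using h2 g hg m' hm' h0
      · exact (h1 g hg m' h0).le
    refine ⟨(weightDeg_le_of_fst_le hv.le e1 e2).trans h3, fun h4 => ?_⟩
    rwa [eq_of_weightDeg_le hv e1 e2 (h4 ▸ h3)]
  have hform : ∀ v, v.1 < 0 → (∀ l ∈ Eq, l v = 0) → (∀ l ∈ Lt, l v ≤ 0) → ∀ g ∈ G, ∀ m,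
      coeffP (initialForm v (F g)) m =
        if weightDeg v m = weightDeg v (a g) then coeffTX (F g) m else 0 := by
    intro v hv h1 h2 g hg m
    exact coeffP_initialForm_of_le hv (fun m hm => (hle v hv h1 h2 g hg m hm).1)
      ⟨a g, hLead g hg, rfl⟩ m
  have hfixed : ∀ v, v.1 < 0 → ((∀ g ∈ G, initialForm v (F g) = g) ↔
      (∀ l ∈ Eq, l v = 0) ∧ ∀ l ∈ Lt, l v < 0) := by
    intro v hv
    constructor
    · intro h
      have hmax : ∀ g ∈ G, ∀ m, m ∈ maxExponents v (F g) ↔ coeffP g m ≠ 0 := by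
        intro g hg m
        nth_rewrite 2 [← h g hg]
        rw [coeffP_initialForm hv]
        constructor
        · intro hm; rw [if_pos hm]; exact hm.1
        · intro hm; exact (ite_ne_right_iff.1 hm).1
      have hlead : ∀ g ∈ G, a g ∈ maxExponents v (F g) := fun g hg =>
        (hmax g hg _).2 (hS.coeff_lead g hg)
      rw [hEq, hLt (fun l => l v < 0)]
      refine ⟨fun g hg m hm => ?_, fun g hg m hm h0 => ?_⟩
      · have := (hmax g hg m).2 hm
        exact le_antisymm ((hlead g hg).2 _ this.1) (this.2 _ (hlead g hg).1)
      · have hm' := coeffTX_ne_zero_of_mem_lowExp hm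
        have h1 := (hlead g hg).2 m hm'
        have h2 : weightDeg v m ≠ weightDeg v (a g) := by
          intro he
          exact (hmax g hg m).1 ⟨hm', fun k hk => he ▸ (hlead g hg).2 k hk⟩ h0
        simpa using lt_of_le_of_ne h1 h2
    · rintro ⟨h1, h2⟩ g hg
      refine coeffP_ext fun m => ?_
      rw [hform v hv h1 (fun l hl => (h2 l hl).le) g hg]
      split_ifs with he
      · by_cases hm : coeffTX (F g) m = 0
        · rw [hm]
          by_contra hne
          exact hS.coeff_ne_zero hg (Ne.symm hne) hm
        · have hlow := (hle v hv h1 (fun l hl => (h2 l hl).le) g hg m hm).2 he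
          by_cases h0 : coeffP g m = 0
          · have := (hLt (fun l => l v < 0)).1 h2 g hg m hlow h0
            simp [he] at this
          · exact hS.coeff_eq hg (hS.mem_class g hg m h0)
      · by_contra hne
        exact he ((hEq v).1 h1 g hg m (Ne.symm hne))
  have hmemH : ∀ v, (∀ l ∈ Eq, l v = 0) → v ∈ homogeneityWeights J := by
    intro v h1
    rw [← hS.span_eq]
    refine mem_homogeneityWeights_of_span fun g hg m m' hm hm' => ?_
    rw [(hEq v).1 h1 g hg m hm, (hEq v).1 h1 g hg m' hm']
  -- If `in_v(I) = J`, then `in_v(F g)` lies in `J` and `v` is a homogeneity weight; reducedness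
  -- then forces `in_v(F g) = g`.
  have hiff : ∀ v, v.1 < 0 →
      (initialIdeal v I = J ↔ (∀ l ∈ Eq, l v = 0) ∧ ∀ l ∈ Lt, l v < 0) := by
    intro v hv
    rw [← hfixed v hv]
    constructor
    · intro h g hg
      exact hfix g hg v (h ▸ mem_homogeneityWeights_initialIdeal hI hv) hv
        (h ▸ initialForm_mem (hF g hg))
    · exact hS.initialIdeal_eq hI hF hred hv
  refine ⟨Eq, Lt, hiff, ?_, ?_⟩
  · intro v v' hv hv' h1 h2 h1' h2' ht
    rw [hS.initialIdeal_eq_span hI hF hred hv (hmemH v h1)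
        (fun g hg m hm => (hle v hv h1 h2 g hg m hm).1),
      hS.initialIdeal_eq_span hI hF hred hv' (hmemH v' h1')
        (fun g hg m hm => (hle v' hv' h1' h2' g hg m hm).1)]
    congr 1
    refine Set.image_congr fun g hg => coeffP_ext fun m => ?_
    rw [hform v hv h1 h2 g hg, hform v' hv' h1' h2' g hg]
    by_cases hm : coeffTX (F g) m = 0
    · simp [hm]
    congr 1
    rw [eq_iff_iff]
    rw [hLt (fun l => l v = 0 ↔ l v' = 0)] at ht
    by_cases h0 : coeffP g m = 0
    · constructor
      · intro he
        have := (ht g hg m ((hle v hv h1 h2 g hg m hm).2 he) h0).1 (by simp [he])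
        simpa [sub_eq_zero] using this
      · intro he
        have := (ht g hg m ((hle v' hv' h1' h2' g hg m hm).2 he) h0).2 (by simp [he])
        simpa [sub_eq_zero] using this
    · exact ⟨fun _ => (hEq v').1 h1' g hg m h0, fun _ => (hEq v).1 h1 g hg m h0⟩
  · intro v v' hv hv' h1 h2 hvv
    obtain ⟨hw1, hw2⟩ := (hiff w hw).1 rfl
    have hseg : ∀ ε : ℝ, 0 < ε → initialIdeal (v + ε • w) I = J := by
      intro ε hε
      rw [hiff]
      · refine ⟨fun l hl => by simp [h1 l hl, hw1 l hl], fun l hl => ?_⟩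
        have e1 := h2 l hl
        have e2 := mul_neg_of_pos_of_neg hε (hw2 l hl)
        simp only [map_add, map_smul, smul_eq_mul]
        linarith
      · have := mul_neg_of_pos_of_neg hε hw
        simp only [Prod.fst_add, Prod.smul_fst, smul_eq_mul]
        linarith
    -- For a lift `f` of a bihomogeneous piece of `h`, the top `w`-part of that piece is the initial
    -- form of `f` for `v + ε w`, a weight whose initial ideal is `J`.
    have htop : ∀ h ∈ initialIdeal v I, ∀ μ : ℝ, (∀ m, coeffP h m ≠ 0 → weightDeg w m ≤ μ) →
        restr {m | weightDeg w m = μ} h ∈ J := by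
      intro h hh μ hμ
      refine mem_of_forall_restr_fiber_mem (weightDeg v) fun κ => ?_
      refine mem_of_forall_restr_fiber_mem (fun m : ExpVec n => m.2.degree) fun d => ?_
      rw [restr_restr, restr_restr]
      obtain ⟨f, hf, hfd, hf1, hf2⟩ := exists_lift_of_mem_initialIdeal hI hv hh κ d
      have hfdeg := isHomogeneous_iff_coeffTX.1 hfd
      by_cases hex : ∃ m, coeffTX f m ≠ 0 ∧ weightDeg v m = κ ∧ weightDeg w m = μ
      · obtain ⟨ε, hε, hpos⟩ := ((eventually_coeffP_initialForm_add_smul hv hw hf1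
          (fun m hm hmκ => hμ m (hf2 m hmκ (hfdeg m hm) ▸ hm)) hex).and
          self_mem_nhdsWithin).exists
        have := initialForm_mem (w := v + ε • w) hf
        rw [hseg ε hpos] at this
        convert this using 1
        refine coeffP_ext fun m => ?_
        rw [hε, coeffP_restr]
        by_cases hd : m.2.degree = d
        · by_cases hκ : weightDeg v m = κ
          · simp [hd, hκ, hf2 m hκ hd]
          · simp [hκ]
        · have : coeffTX f m = 0 := by
            by_contra h0
            exact hd (hfdeg m h0)
          simp [this, hd]
      · rw [restr_eq_zero_of_forall]
        · exact J.zero_mem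
        · rintro m hm ⟨⟨e1, e2⟩, e3⟩
          exact hex ⟨m, by rwa [hf2 m e2 e1], e2, e3⟩
    -- `in_v(I) = in_{v'}(I)` is `v'`-homogeneous, so it contains the `v'`-pieces of `in_v(F g)`.
    -- Their parts of top `w`-weight are the `v'`-pieces of `g`.
    have hpart : ∀ g ∈ G, ∀ κ : ℝ, restr {m | weightDeg v' m = κ} g ∈ J := by
      intro g hg κ
      have e1 : restr {m | weightDeg v' m = κ} (initialForm v (F g)) ∈ initialIdeal v I := by
        have e2 := mem_homogeneityWeights_initialIdeal hI hv'
        rw [hvv] at e2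
        exact e2 _ (initialForm_mem (hF g hg)) κ
      have e3 := htop _ e1 (weightDeg w (a g)) (by
        intro m hm
        rw [coeffP_restr, hform v hv h1 h2 g hg] at hm
        have := (ite_ne_right_iff.1 (ite_ne_right_iff.1 hm).2).2
        exact hS.weightDeg_le hg this)
      convert e3 using 1
      rw [restr_restr]
      refine coeffP_ext fun m => ?_
      rw [coeffP_restr, coeffP_restr, hform v hv h1 h2 g hg]
      by_cases h0 : coeffP g m = 0
      · have : coeffTX (F g) m ≠ 0 → weightDeg w m ≠ weightDeg w (a g) := by
          intro hne
          exact (hS.lower g hg m (by rwa [h0])).ne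
        by_cases hne : coeffTX (F g) m = 0
        · simp [h0, hne]
        · simp [h0, this hne]
      · rw [hS.coeff_eq hg (hS.mem_class g hg m h0), (hEq v).1 h1 g hg m h0, if_pos rfl]
        simp [hS.mem_class g hg m h0 w hwJ]
    have hv'J : v' ∈ homogeneityWeights J := by
      have hspan : Ideal.span {h | ∃ g ∈ G, ∃ κ : ℝ, h = restr {m | weightDeg v' m = κ} g} = J := by
        refine le_antisymm (Ideal.span_le.2 ?_) ?_
        · rintro _ ⟨g, hg, κ, rfl⟩
          exact hpart g hg κ
        · rw [← hS.span_eq, Ideal.span_le]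
          intro g hg
          refine mem_of_forall_restr_fiber_mem (weightDeg v') fun κ => ?_
          exact Ideal.subset_span ⟨g, hg, κ, rfl⟩
      rw [← hspan]
      refine mem_homogeneityWeights_of_span ?_
      rintro _ ⟨g, hg, κ, rfl⟩ m m' hm hm'
      rw [coeffP_restr] at hm hm'
      exact (ite_ne_right_iff.1 hm).1.trans (ite_ne_right_iff.1 hm').1.symm
    -- The initial form for `v' + ε w` is the top `w`-part of `in_{v'}(F g)`, hence in `J` by
    -- `htop`, hence equal to `g` by reducedness. Letting `ε` tend to `0` then gives the weak
    -- conditions at `v'`.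
    have hev : ∀ᶠ ε in 𝓝[>] (0 : ℝ), ∀ g ∈ G, initialForm (v' + ε • w) (F g) = g := by
      rw [Filter.eventually_all_finset]
      intro g hg
      have hFg : F g ≠ 0 := fun h0 => hLead g hg (by rw [h0, coeffTX_zero])
      obtain ⟨κ, hκ, hκ'⟩ := exists_top_weight hv' hFg
      obtain ⟨m₀, hm₀, hmax⟩ := Set.exists_max_image _ (weightDeg w)
        (maxExponents_finite hv' (F g)) (maxExponents_nonempty hv' hFg)
      have hmem : ∀ m, m ∈ maxExponents v' (F g) ↔ coeffTX (F g) m ≠ 0 ∧ weightDeg v' m = κ := by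
        intro m
        obtain ⟨k, hk, hkκ⟩ := hκ'
        constructor
        · intro hm
          exact ⟨hm.1, le_antisymm (hκ m hm.1) (hkκ ▸ hm.2 k hk)⟩
        · rintro ⟨e1, e2⟩
          exact ⟨e1, fun k hk => e2 ▸ hκ k hk⟩
      have hform' := coeffP_initialForm_of_le hv' hκ hκ'
      have hin := htop (initialForm v' (F g)) (hvv ▸ initialForm_mem (hF g hg)) (weightDeg w m₀) (by
        intro m hm
        rw [hform'] at hm
        obtain ⟨e1, e2⟩ := ite_ne_right_iff.1 hm
        exact hmax m ((hmem m).2 ⟨e2, e1⟩))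
      filter_upwards [eventually_coeffP_initialForm_add_smul hv' hw hκ
        (fun m hm hmκ => hmax m ((hmem m).2 ⟨hm, hmκ⟩))
        ⟨m₀, ((hmem m₀).1 hm₀).1, ((hmem m₀).1 hm₀).2, rfl⟩, self_mem_nhdsWithin]
        with ε hε (hpos : 0 < ε)
      refine hfix g hg _ (add_smul_mem_homogeneityWeights hv'J hwJ ε) ?_ ?_
      · have := mul_neg_of_pos_of_neg hpos hw
        simp only [Prod.fst_add, Prod.smul_fst, smul_eq_mul]
        linarith
      · convert hin using 1
        refine coeffP_ext fun m => ?_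
        rw [hε, coeffP_restr, hform']
        by_cases e1 : weightDeg v' m = κ <;> by_cases e2 : weightDeg w m = weightDeg w m₀ <;>
          simp only [Set.mem_ofPred_eq, e1, e2, and_self, and_false, false_and, if_true, if_false]
    have hev' : ∀ᶠ ε in 𝓝[>] (0 : ℝ), (∀ l ∈ Eq, l (v' + ε • w) = 0) ∧
        ∀ l ∈ Lt, l (v' + ε • w) < 0 := by
      filter_upwards [hev, self_mem_nhdsWithin] with ε hε (hpos : 0 < ε)
      refine (hfixed _ ?_).1 hε
      have := mul_neg_of_pos_of_neg hpos hw
      simp only [Prod.fst_add, Prod.smul_fst, smul_eq_mul]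
      linarith
    have hlim : ∀ l : StrongDual ℝ (ℝ × (Fin n → ℝ)),
        Tendsto (fun ε : ℝ => l (v' + ε • w)) (𝓝[>] 0) (𝓝 (l v')) := by
      intro l
      have : Continuous fun ε : ℝ => l (v' + ε • w) := by fun_prop
      have h := this.tendsto 0
      simp only [zero_smul, add_zero] at h
      exact h.mono_left nhdsWithin_le_nhds
    refine ⟨fun l hl => ?_, fun l hl => ?_⟩
    · refine le_antisymm (le_of_tendsto (hlim l) ?_) (ge_of_tendsto (hlim l) ?_)
      · filter_upwards [hev'] with ε hε using (hε.1 l hl).le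
      · filter_upwards [hev'] with ε hε using (hε.1 l hl).ge
    · refine le_of_tendsto (hlim l) ?_
      filter_upwards [hev'] with ε hε using (hε.2 l hl).le

end Cells

/-! ### Finiteness of the set of initial ideals. -/

section Finiteness

variable {R : Type*} [CommRing R] {n : ℕ}

theorem initialForm_congr {v w : ℝ × (Fin n → ℝ)} {f : XSeries R n}
    (h : maxExponents v f = maxExponents w f) : initialForm v f = initialForm w f := by
  unfold initialForm
  rw [h]

/-- Along an ultrafilter of weights, the initial forms of a fixed series stabilize. -/
theorem exists_eventually_initialForm_eq {ι : Type*} (U : Ultrafilter ι)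
    {v : ι → ℝ × (Fin n → ℝ)} (hv : ∀ k, (v k).1 < 0) (f : XSeries R n) :
    ∃ g, ∀ᶠ k in U, initialForm (v k) f = g := by
  have hfin : (𝒫 (lowExp f : Set (ExpVec n))).Finite := (lowExp f).finite_toSet.finite_subsets
  have hmem : (⋃ A ∈ 𝒫 (lowExp f : Set (ExpVec n)), {k | maxExponents (v k) f = A}) ∈ U := by
    refine Filter.mem_of_superset Filter.univ_mem fun k _ => ?_
    simp only [Set.mem_iUnion]
    exact ⟨_, maxExponents_subset_lowExp (hv k) f, rfl⟩
  obtain ⟨A, -, hA⟩ := (Ultrafilter.finite_biUnion_mem_iff hfin).1 hmem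
  obtain ⟨k₀, hk₀⟩ := U.nonempty_of_mem hA
  refine ⟨initialForm (v k₀) f, Filter.mem_of_superset hA fun k hk => ?_⟩
  exact initialForm_congr (hk.trans hk₀.symm)

/-- An `x`-homogeneous ideal has only finitely many initial ideals. -/
theorem finite_initialIdeals [IsNoetherianRing R] {I : Ideal (XSeries R n)}
    (hI : IsXHomogeneous I) :
    {K | ∃ v : ℝ × (Fin n → ℝ), v.1 < 0 ∧ initialIdeal v I = K}.Finite := by
  classical
  by_contra hinf
  let K := Set.Infinite.natEmbedding _ hinf
  choose v hv hvK using fun k => (K k).2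
  let U : Ultrafilter ℕ := Filter.hyperfilter ℕ
  choose L hL using exists_eventually_initialForm_eq (R := R) U hv
  let S : Set (XSeries R n) := {f | f ∈ I ∧ ∃ d : ℕ, f.IsHomogeneous d}
  -- The limit initial forms generate a limit ideal. Finitely many of them suffice, and these are
  -- simultaneously genuine initial forms for almost all `k`.
  obtain ⟨T, hTS, hT⟩ := (Submodule.fg_span_iff_fg_span_finset_subset (R := TXPoly R n) (L '' S)).1
    ((isNoetherianRing_iff_ideal_fg (TXPoly R n)).1 inferInstance _)
  set J : Ideal (TXPoly R n) := Ideal.span (L '' S) with hJ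
  replace hT : J = Ideal.span (T : Set (TXPoly R n)) := hT
  have hf : ∀ g : TXPoly R n, ∃ f, g ∈ T → f ∈ S ∧ L f = g := by
    intro g
    by_cases hg : g ∈ T
    · obtain ⟨f, hf, hfg⟩ := hTS hg
      exact ⟨f, fun _ => ⟨hf, hfg⟩⟩
    · exact ⟨0, fun h => absurd h hg⟩
  choose f hf using hf
  have hgood : ∀ᶠ k in U, ∀ g ∈ T, initialForm (v k) (f g) = g := by
    rw [Filter.eventually_all_finset]
    intro g hg
    have := hL (f g)
    rwa [(hf g hg).2] at this
  have hmax : ∀ k, (∀ g ∈ T, initialForm (v k) (f g) = g) → ∀ g ∈ T, ∀ m, coeffP g m ≠ 0 →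
      m ∈ maxExponents (v k) (f g) := by
    intro k hk g hg m hm
    rw [← hk g hg, coeffP_initialForm (hv k)] at hm
    exact (ite_ne_right_iff.1 hm).1
  have hweight : ∀ k, (∀ g ∈ T, initialForm (v k) (f g) = g) → v k ∈ homogeneityWeights J := by
    intro k hk
    rw [hT]
    refine mem_homogeneityWeights_of_span fun g hg m m' hm hm' => ?_
    have h1 := hmax k hk g hg m hm
    have h2 := hmax k hk g hg m' hm'
    exact le_antisymm (h2.2 _ h1.1) (h1.2 _ h2.1)
  have hdeg : xDegWeight n ∈ homogeneityWeights J := by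
    obtain ⟨k, hk⟩ := hgood.exists
    rw [hT]
    refine mem_homogeneityWeights_of_span fun g hg m m' hm hm' => ?_
    obtain ⟨d, hd⟩ := (hf g hg).1.2
    rw [isHomogeneous_iff_coeffTX] at hd
    rw [weightDeg_xDegWeight, weightDeg_xDegWeight, hd m (hmax k hk g hg m hm).1,
      hd m' (hmax k hk g hg m' hm').1]
  have hred : ∀ r ∈ I, ∀ d : ℕ, r.IsHomogeneous d → IsReducedModulo J r → r = 0 := by
    intro r hr d hrd hrJ
    by_contra h0
    obtain ⟨k, hk1, hk2⟩ := (hgood.and (hL r)).exists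
    refine hrJ.initialForm_notMem h0 (hv k) (hweight k hk1) ?_
    rw [hk2]
    exact Ideal.subset_span ⟨r, ⟨hr, d, hrd⟩, rfl⟩
  -- The limit ideal is contained in `in_{v k}(I)`, and no nonzero reduced homogeneous element of
  -- `I` exists for it, so division gives equality. Distinct initial ideals cannot agree for almost
  -- all `k`.
  have hK : ∀ᶠ k in U, initialIdeal (v k) I = J := by
    filter_upwards [hgood] with k hk
    have hle : J ≤ initialIdeal (v k) I := by
      rw [hT, Ideal.span_le]
      intro g hg
      rw [← hk g hg]
      exact initialForm_mem (hf g hg).1.1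
    obtain ⟨G, F, a, hS, hF, -⟩ := exists_reduced_liftSystem hI (hv k) hle (hweight k hk) hdeg
    exact hS.initialIdeal_eq hI hF hred (hv k) fun g hg => hS.initialForm_eq hg
  obtain ⟨k₀, hk₀⟩ := hK.exists
  refine Filter.notMem_hyperfilter_of_finite (Set.finite_singleton k₀)
    (Filter.mem_of_superset hK fun k hk => ?_)
  refine K.injective (Subtype.ext ?_)
  rw [← hvK k, ← hvK k₀, hk₀]
  exact hk

end Finiteness

/-! ### Faces of polyhedra via tight inequalities. -/

section Cuts

variable {E : Type*} [AddCommGroup E] [Module ℝ E] [TopologicalSpace E]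

/-- The points of `A` which satisfy the linear inequalities `l x ≤ 0` for `l ∈ L`. -/
def cutSet (A : Set E) (L : Finset (StrongDual ℝ E)) : Set E := {x | x ∈ A ∧ ∀ l ∈ L, l x ≤ 0}

/-- The points of `cutSet A L` at which all inequalities hold with equality that do so at `v`. -/
def tightFace (A : Set E) (L : Finset (StrongDual ℝ E)) (v : E) : Set E :=
  {x | x ∈ cutSet A L ∧ ∀ l ∈ L, l v = 0 → l x = 0}

/-- A relative interior point: take `v` with the fewest tight inequalities. At the midpoint of `v`
and `x` only inequalities tight at both remain tight, so minimality makes those tight at `v` tight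
at `x`. -/
theorem exists_forall_tight (L : Finset (StrongDual ℝ E)) {S : Set E} (hne : S.Nonempty)
    (hmid : ∀ x ∈ S, ∀ y ∈ S, x + (-1 / 2 : ℝ) • (x - y) ∈ S) (hS : ∀ x ∈ S, ∀ l ∈ L, l x ≤ 0) :
    ∃ v ∈ S, ∀ x ∈ S, ∀ l ∈ L, l v = 0 → l x = 0 := by
  classical
  obtain ⟨k, ⟨v, hv, rfl⟩, hmin⟩ := (wellFounded_lt (α := ℕ)).has_min
    ((fun x : E => (L.filter fun l : StrongDual ℝ E => l x = 0).card) '' S) (hne.image _)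
  refine ⟨v, hv, fun x hx l hl hlv => ?_⟩
  by_contra hlx
  refine hmin _ ⟨_, hmid v hv x hx, rfl⟩ (Finset.card_lt_card ?_)
  have hval : ∀ l' : StrongDual ℝ E, l' (v + (-1 / 2 : ℝ) • (v - x)) = (l' v + l' x) / 2 := by
    intro l'
    simp only [map_add, map_smul, map_sub, smul_eq_mul]
    ring
  rw [Finset.ssubset_iff_of_subset]
  · refine ⟨l, by simp [hl, hlv], ?_⟩
    simp only [Finset.mem_filter, hval, hlv, not_and]
    intro _ h
    exact hlx (by linarith)
  · intro l' hl'
    simp only [Finset.mem_filter, hval] at hl' ⊢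
    have h1 := hS v hv l' hl'.1
    have h2 := hS x hx l' hl'.1
    exact ⟨hl'.1, by linarith [hl'.2]⟩

theorem exists_pos_forall_le (L : Finset (StrongDual ℝ E)) {v y : E} (hv : ∀ l ∈ L, l v ≤ 0)
    (hvx : ∀ l ∈ L, l v = 0 → l y ≤ 0) : ∃ ε : ℝ, 0 < ε ∧ ∀ l ∈ L, l (v + ε • y) ≤ 0 := by
  have hev : ∀ᶠ ε in 𝓝[>] (0 : ℝ), ∀ l ∈ L, l (v + ε • y) ≤ 0 := by
    rw [Filter.eventually_all_finset]
    intro l hl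
    simp only [map_add, map_smul, smul_eq_mul]
    rcases (hv l hl).lt_or_eq with h | h
    · have hcont : ContinuousAt (fun ε : ℝ => l v + ε * l y) 0 := by fun_prop
      have := (hcont.eventually (gt_mem_nhds (by simpa using h))).filter_mono
        (nhdsWithin_le_nhds (s := Set.Ioi 0))
      filter_upwards [this] with ε hε using hε.le
    · filter_upwards [self_mem_nhdsWithin] with ε (hpos : 0 < ε)
      have := hvx l hl h
      rw [h, zero_add]
      exact mul_nonpos_of_nonneg_of_nonpos hpos.le this
  obtain ⟨ε, h1, h2⟩ := (hev.and self_mem_nhdsWithin).exists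
  exact ⟨ε, h2, h1⟩

/-- The sum of the functionals that vanish at `v` is nonpositive on the polyhedron, and is zero
exactly where each of them vanishes. -/
theorem isFaceOf_tightFace {A : Set E} {L : Finset (StrongDual ℝ E)} {v : E}
    (hv : v ∈ cutSet A L) : IsFaceOf (tightFace A L v) (cutSet A L) := by
  classical
  refine ⟨⟨v, hv, fun _ _ h => h⟩, fun _ => ⟨∑ l ∈ L.filter fun l => l v = 0, l, ?_⟩⟩
  ext x
  have hsum : ∀ y, (∑ l ∈ L.filter fun l => l v = 0, l) y = ∑ l ∈ L.filter fun l => l v = 0, l y :=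
    fun y => by simp
  simp only [hsum]
  constructor
  · rintro ⟨hx, hxt⟩
    refine ⟨hx, fun y hy => ?_⟩
    have : ∑ l ∈ L.filter fun l => l v = 0, l x = 0 :=
      Finset.sum_eq_zero fun l hl => hxt l (Finset.mem_filter.1 hl).1 (Finset.mem_filter.1 hl).2
    rw [this]
    exact Finset.sum_nonpos fun l hl => hy.2 l (Finset.mem_filter.1 hl).1
  · rintro ⟨hx, hmax⟩
    refine ⟨hx, fun l hl hlv => ?_⟩
    have h1 := hmax v hv
    rw [Finset.sum_eq_zero (f := fun l : StrongDual ℝ E => l v)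
      fun l hl => (Finset.mem_filter.1 hl).2] at h1
    have h2 := Finset.sum_nonpos (s := L.filter fun l => l v = 0) (f := fun l => l x)
      fun l hl => hx.2 l (Finset.mem_filter.1 hl).1
    have h3 := (Finset.sum_eq_zero_iff_of_nonpos
      fun l hl => hx.2 l (Finset.mem_filter.1 hl).1).1 (le_antisymm h2 h1)
    exact h3 l (Finset.mem_filter.2 ⟨hl, hlv⟩)

/-- Take `v` relatively interior to `F`. From a point `x` of the tight face one can move through `v`
and slightly beyond, so a functional maximal at `v` has the same value at `x`. -/
theorem exists_eq_tightFace {A : Set E} {L : Finset (StrongDual ℝ E)}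
    (hA : ∀ x ∈ A, ∀ y ∈ A, ∀ ε : ℝ, x + ε • (x - y) ∈ A) {F : Set E}
    (hF : IsFaceOf F (cutSet A L)) : ∃ v ∈ cutSet A L, F = tightFace A L v := by
  obtain ⟨hne, hex⟩ := hF
  obtain ⟨φ, hφ⟩ := hex hne
  have hFS : ∀ x ∈ F, x ∈ cutSet A L := fun x hx => by rw [hφ] at hx; exact hx.1
  have hmid : ∀ x ∈ F, ∀ y ∈ F, x + (-1 / 2 : ℝ) • (x - y) ∈ F := by
    intro x hx y hy
    rw [hφ] at hx hy ⊢
    refine ⟨⟨hA x hx.1.1 y hy.1.1 _, fun l hl => ?_⟩, fun z hz => ?_⟩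
    · have h1 := hx.1.2 l hl
      have h2 := hy.1.2 l hl
      simp only [map_add, map_smul, map_sub, smul_eq_mul]
      linarith
    · have h1 := hx.2 z hz
      have h2 := hy.2 z hz
      simp only [map_add, map_smul, map_sub, smul_eq_mul]
      linarith
  obtain ⟨v, hv, hvt⟩ := exists_forall_tight L hne hmid fun x hx => (hFS x hx).2
  refine ⟨v, hFS v hv, Set.Subset.antisymm (fun x hx => ⟨hFS x hx, hvt x hx⟩) ?_⟩
  rintro x ⟨hx, hxt⟩
  obtain ⟨ε, hε, hle⟩ := exists_pos_forall_le L (y := v - x) (hFS v hv).2 (by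
    intro l hl h0
    rw [map_sub, h0, hxt l hl h0, sub_zero])
  have hmem : v + ε • (v - x) ∈ cutSet A L := ⟨hA v (hFS v hv).1 x hx.1 ε, hle⟩
  rw [hφ] at hv ⊢
  refine ⟨hx, fun y hy => (hv.2 y hy).trans ?_⟩
  have := hv.2 _ hmem
  simp only [map_add, map_smul, map_sub, smul_eq_mul] at this
  nlinarith

end Cuts

/-! ### Gröbner cones, slices and boundary cones as polyhedra. -/

section GroebnerCones

variable {R : Type*} [CommRing R] {n : ℕ} {I : Ideal (XSeries R n)} {w : ℝ × (Fin n → ℝ)}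
  {Eq Lt : Finset (StrongDual ℝ (ℝ × (Fin n → ℝ)))}

/-- The solutions of the equations `Eq` with first coordinate `c`. -/
def levelSet (Eq : Finset (StrongDual ℝ (ℝ × (Fin n → ℝ)))) (c : ℝ) : Set (ℝ × (Fin n → ℝ)) :=
  {x | x.1 = c ∧ ∀ l ∈ Eq, l x = 0}

theorem levelSet_affine (c : ℝ) : ∀ x ∈ levelSet Eq c, ∀ y ∈ levelSet Eq c, ∀ ε : ℝ,
    x + ε • (x - y) ∈ levelSet Eq c := by
  rintro x ⟨hx, hx'⟩ y ⟨hy, hy'⟩ ε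
  refine ⟨by simp [hx, hy], fun l hl => by simp [hx' l hl, hy' l hl]⟩

theorem IsCellDescription.self (hC : IsCellDescription I w Eq Lt) (hw : w.1 < 0) :
    (∀ l ∈ Eq, l w = 0) ∧ ∀ l ∈ Lt, l w < 0 := (hC.mem_iff w hw).1 rfl

theorem mem_closure_of_forall_add_smul {S : Set (ℝ × (Fin n → ℝ))} {x y : ℝ × (Fin n → ℝ)}
    (h : ∀ ε : ℝ, 0 < ε → x + ε • y ∈ S) : x ∈ closure S := by
  have hc : Continuous fun ε : ℝ => x + ε • y := by fun_prop
  have ht := hc.tendsto 0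
  simp only [zero_smul, add_zero] at ht
  refine mem_closure_of_tendsto (ht.mono_left (nhdsWithin_le_nhds (s := Set.Ioi 0))) ?_
  filter_upwards [self_mem_nhdsWithin] with ε hε using h ε hε

theorem isClosed_linear_conditions :
    IsClosed {v : ℝ × (Fin n → ℝ) | v.1 ≤ 0 ∧ (∀ l ∈ Eq, l v = 0) ∧ ∀ l ∈ Lt, l v ≤ 0} := by
  simp only [Set.ofPred_and, Set.ofPred_forall]
  refine (isClosed_le continuous_fst continuous_const).inter (IsClosed.inter ?_ ?_)
  · exact isClosed_biInter fun l _ => isClosed_eq l.continuous continuous_const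
  · exact isClosed_biInter fun l _ => isClosed_le l.continuous continuous_const

/-- Adding a positive multiple of `w`, where the inequalities are strict, moves any point of the
closed cone into the cell. -/
theorem IsCellDescription.groebnerCone_eq (hC : IsCellDescription I w Eq Lt) (hw : w.1 < 0) :
    groebnerCone I w = {v | v.1 ≤ 0 ∧ (∀ l ∈ Eq, l v = 0) ∧ ∀ l ∈ Lt, l v ≤ 0} := by
  refine Set.Subset.antisymm ?_ ?_
  · refine closure_minimal ?_ isClosed_linear_conditions
    rintro v ⟨hv, hvI⟩
    obtain ⟨h1, h2⟩ := (hC.mem_iff v hv).1 hvI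
    exact ⟨hv.le, h1, fun l hl => (h2 l hl).le⟩
  · rintro v ⟨hv, h1, h2⟩
    obtain ⟨hw1, hw2⟩ := hC.self hw
    refine mem_closure_of_forall_add_smul (y := w) fun ε hε => ?_
    have hneg : (v + ε • w).1 < 0 := by
      have := mul_neg_of_pos_of_neg hε hw
      simp only [Prod.fst_add, Prod.smul_fst, smul_eq_mul]
      linarith
    refine ⟨hneg, (hC.mem_iff _ hneg).2 ⟨fun l hl => by simp [h1 l hl, hw1 l hl], fun l hl => ?_⟩⟩
    have e1 := h2 l hl
    have e2 := mul_neg_of_pos_of_neg hε (hw2 l hl)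
    simp only [map_add, map_smul, smul_eq_mul]
    linarith

theorem IsCellDescription.groebnerSlice_eq (hC : IsCellDescription I w Eq Lt) (hw : w.1 < 0) :
    groebnerSlice I w = cutSet (levelSet Eq (-1)) Lt := by
  ext x
  simp only [groebnerSlice, hC.groebnerCone_eq hw, cutSet, levelSet, Set.mem_inter_iff,
    Set.mem_ofPred_eq, Set.mem_prod, Set.mem_singleton_iff, Set.mem_univ, and_true]
  constructor
  · rintro ⟨⟨-, h1, h2⟩, h3⟩; exact ⟨⟨h3, h1⟩, h2⟩
  · rintro ⟨⟨h3, h1⟩, h2⟩; exact ⟨⟨by rw [h3]; norm_num, h1, h2⟩, h3⟩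

theorem IsCellDescription.boundaryCone_eq (hC : IsCellDescription I w Eq Lt) (hw : w.1 < 0) :
    boundaryCone I w = cutSet (levelSet Eq 0) Lt := by
  ext x
  simp only [boundaryCone, hC.groebnerCone_eq hw, cutSet, levelSet, Set.mem_inter_iff,
    Set.mem_ofPred_eq, Set.mem_prod, Set.mem_singleton_iff, Set.mem_univ, and_true]
  constructor
  · rintro ⟨⟨-, h1, h2⟩, h3⟩; exact ⟨⟨h3, h1⟩, h2⟩
  · rintro ⟨⟨h3, h1⟩, h2⟩; exact ⟨⟨by rw [h3], h1, h2⟩, h3⟩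

/-- The cone of a weight `v` in the cone of `w` is the smallest face of the latter which
contains `v`. -/
theorem IsCellDescription.groebnerCone_eq_of_mem [IsNoetherianRing R] (hI : IsXHomogeneous I)
    (hC : IsCellDescription I w Eq Lt) (hw : w.1 < 0) {v : ℝ × (Fin n → ℝ)} (hv : v.1 < 0)
    (hvw : v ∈ groebnerCone I w) :
    groebnerCone I v = {x | x ∈ groebnerCone I w ∧ ∀ l ∈ Lt, l v = 0 → l x = 0} := by
  have hcone := hC.groebnerCone_eq hw
  rw [hcone] at hvw
  obtain ⟨-, hv1, hv2⟩ := hvw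
  refine Set.Subset.antisymm ?_ ?_
  · refine closure_minimal ?_ ?_
    · rintro v' ⟨hv', hvv⟩
      obtain ⟨h1, h2⟩ := hC.absorb v v' hv hv' hv1 hv2 hvv
      refine ⟨by rw [hcone]; exact ⟨hv'.le, h1, h2⟩, fun l hl hlv => ?_⟩
      obtain ⟨Eq', Lt', hC'⟩ := exists_isCellDescription hI hv
      obtain ⟨hs1, hs2⟩ := hC'.self hv
      obtain ⟨ht1, ht2⟩ := (hC'.mem_iff v' hv').1 hvv
      -- The cell of `v` is relatively open, so moving from `v'` slightly beyond `v` stays in it.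
      -- There `absorb` gives `l ≤ 0`, while the value is `-ε * l v'`; thus `l v' < 0` is
      -- impossible.
      have hev : ∀ᶠ ε in 𝓝[>] (0 : ℝ), (v + ε • (v - v')).1 < 0 ∧
          ∀ l ∈ Lt', l (v + ε • (v - v')) < 0 := by
        have hlt : ∀ φ : ℝ × (Fin n → ℝ) → ℝ, Continuous φ → φ v < 0 →
            ∀ᶠ ε in 𝓝[>] (0 : ℝ), φ (v + ε • (v - v')) < 0 := by
          intro φ hφ hφv
          have hc : ContinuousAt (fun ε : ℝ => φ (v + ε • (v - v'))) 0 := by fun_prop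
          exact (hc.eventually (gt_mem_nhds (by simpa using hφv))).filter_mono nhdsWithin_le_nhds
        refine (hlt _ continuous_fst hv).and ?_
        rw [Filter.eventually_all_finset]
        exact fun l hl => hlt l l.continuous (hs2 l hl)
      obtain ⟨ε, ⟨h3, h4⟩, hε⟩ := (hev.and self_mem_nhdsWithin).exists
      have h5 := (hC'.mem_iff _ h3).2 ⟨fun l hl => by simp [hs1 l hl, ht1 l hl], h4⟩
      have h6 := (hC.absorb v _ hv h3 hv1 hv2 h5).2 l hl
      simp only [map_add, map_smul, map_sub, smul_eq_mul, hlv] at h6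
      have h7 := h2 l hl
      have hε' : 0 < ε := hε
      nlinarith
    · simp only [Set.ofPred_and, Set.ofPred_forall]
      refine isClosed_closure.inter ?_
      exact isClosed_biInter fun l _ => isClosed_iInter fun _ =>
        isClosed_eq l.continuous continuous_const
  · rintro x ⟨hx, hxt⟩
    rw [hcone] at hx
    obtain ⟨hx0, hx1, hx2⟩ := hx
    refine mem_closure_of_forall_add_smul (y := v) fun ε hε => ?_
    have hneg : (x + ε • v).1 < 0 := by
      have := mul_neg_of_pos_of_neg hε hv
      simp only [Prod.fst_add, Prod.smul_fst, smul_eq_mul]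
      linarith
    refine ⟨hneg, (hC.eq_of_tight v _ hv hneg hv1 hv2 ?_ ?_ ?_).symm⟩
    · exact fun l hl => by simp [hx1 l hl, hv1 l hl]
    · intro l hl
      have e1 := hx2 l hl
      have e2 := mul_nonpos_of_nonneg_of_nonpos hε.le (hv2 l hl)
      simp only [map_add, map_smul, smul_eq_mul]
      linarith
    · intro l hl
      simp only [map_add, map_smul, smul_eq_mul]
      constructor
      · intro h
        rw [h, hxt l hl h]
        ring
      · intro h
        have e1 := hx2 l hl
        have e2 := hv2 l hl
        nlinarith

theorem IsCellDescription.groebnerSlice_eq_tightFace [IsNoetherianRing R]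
    (hI : IsXHomogeneous I) (hC : IsCellDescription I w Eq Lt) (hw : w.1 < 0)
    {v : ℝ × (Fin n → ℝ)} (hv : v ∈ groebnerSlice I w) :
    groebnerSlice I v = tightFace (levelSet Eq (-1)) Lt v := by
  have hv0 : v.1 < 0 := by
    rw [hC.groebnerSlice_eq hw] at hv
    rw [hv.1.1]
    norm_num
  unfold tightFace
  rw [← hC.groebnerSlice_eq hw, groebnerSlice, groebnerSlice,
    hC.groebnerCone_eq_of_mem hI hw hv0 hv.1]
  ext x
  simp only [Set.mem_inter_iff, Set.mem_ofPred_eq]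
  tauto

theorem IsCellDescription.boundaryCone_eq_tightFace [IsNoetherianRing R]
    (hI : IsXHomogeneous I) (hC : IsCellDescription I w Eq Lt) (hw : w.1 < 0)
    {v : ℝ × (Fin n → ℝ)} (hv : v ∈ groebnerSlice I w) :
    boundaryCone I v = tightFace (levelSet Eq 0) Lt v := by
  have hv0 : v.1 < 0 := by
    rw [hC.groebnerSlice_eq hw] at hv
    rw [hv.1.1]
    norm_num
  unfold tightFace
  rw [← hC.boundaryCone_eq hw, boundaryCone, boundaryCone,
    hC.groebnerCone_eq_of_mem hI hw hv0 hv.1]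
  ext x
  simp only [Set.mem_inter_iff, Set.mem_ofPred_eq]
  tauto

theorem IsCellDescription.normalize_mem (hC : IsCellDescription I w Eq Lt) (hw : w.1 < 0) :
    (-w.1)⁻¹ • w ∈ groebnerSlice I w ∧ ∀ l ∈ Lt, l ((-w.1)⁻¹ • w) < 0 := by
  obtain ⟨h1, h2⟩ := hC.self hw
  have hpos : 0 < (-w.1)⁻¹ := inv_pos.2 (by linarith)
  have hlt : ∀ l ∈ Lt, l ((-w.1)⁻¹ • w) < 0 := fun l hl => by
    rw [map_smul, smul_eq_mul]
    exact mul_neg_of_pos_of_neg hpos (h2 l hl)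
  refine ⟨?_, hlt⟩
  rw [hC.groebnerSlice_eq hw]
  refine ⟨⟨?_, fun l hl => by simp [h1 l hl]⟩, fun l hl => (hlt l hl).le⟩
  rw [Prod.smul_fst, smul_eq_mul, inv_neg, neg_mul, inv_mul_cancel₀ hw.ne]

end GroebnerCones

/-! ### The complex of slices and the recession cones. -/

section GroebnerComplex

variable {R : Type*} [CommRing R] {n : ℕ} {I : Ideal (XSeries R n)} {w : ℝ × (Fin n → ℝ)}
  {Eq Lt : Finset (StrongDual ℝ (ℝ × (Fin n → ℝ)))}

theorem finite_of_initialIdeal_congr [IsNoetherianRing R] (hI : IsXHomogeneous I) {X : Type*}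
    {Φ : ℝ × (Fin n → ℝ) → X}
    (hΦ : ∀ v w, initialIdeal v I = initialIdeal w I → Φ v = Φ w) :
    {x | ∃ w : ℝ × (Fin n → ℝ), w.1 < 0 ∧ x = Φ w}.Finite := by
  have hfin := (finite_initialIdeals hI).to_subtype
  choose σ hσ using
    fun K : {K | ∃ v : ℝ × (Fin n → ℝ), v.1 < 0 ∧ initialIdeal v I = K} => K.2
  refine (Set.finite_range fun K => Φ (σ K)).subset ?_
  rintro _ ⟨w, hw, rfl⟩
  exact ⟨⟨initialIdeal w I, w, hw, rfl⟩, hΦ _ _ (hσ _).2⟩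

theorem exists_initialIdeal_eq_mem_ultrafilter [IsNoetherianRing R] (hI : IsXHomogeneous I)
    {ι : Type*} (U : Ultrafilter ι) {v : ι → ℝ × (Fin n → ℝ)} (hv : ∀ k, (v k).1 < 0) :
    ∃ w : ℝ × (Fin n → ℝ), w.1 < 0 ∧ ∀ᶠ k in U, initialIdeal (v k) I = initialIdeal w I := by
  have hmem : (⋃ K ∈ {K | ∃ v : ℝ × (Fin n → ℝ), v.1 < 0 ∧ initialIdeal v I = K},
      {k | initialIdeal (v k) I = K}) ∈ U := by
    refine Filter.mem_of_superset Filter.univ_mem fun k _ => ?_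
    simp only [Set.mem_iUnion]
    exact ⟨_, ⟨v k, hv k, rfl⟩, rfl⟩
  obtain ⟨K, ⟨w, hw, rfl⟩, hK⟩ := (Ultrafilter.finite_biUnion_mem_iff (finite_initialIdeals hI)).1 hmem
  exact ⟨w, hw, hK⟩

theorem self_mem_groebnerCone (hw : w.1 < 0) : w ∈ groebnerCone I w :=
  subset_closure ⟨hw, rfl⟩

theorem sUnion_groebnerSlice :
    ⋃₀ {P | ∃ w : ℝ × (Fin n → ℝ), w.1 < 0 ∧ P = groebnerSlice I w} = {-1} ×ˢ Set.univ := by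
  refine Set.Subset.antisymm ?_ ?_
  · rintro x ⟨_, ⟨w, -, rfl⟩, hx⟩
    exact hx.2
  · intro x hx
    have hx1 : x.1 = -1 := by simpa using hx
    exact ⟨_, ⟨x, by rw [hx1]; norm_num, rfl⟩, self_mem_groebnerCone (by rw [hx1]; norm_num), hx⟩

/-- Approach `u` by weights with negative first coordinate. As there are finitely many initial
ideals, one of them is shared by almost all of these weights, and `u` lies in the closure of its
cell. -/
theorem sUnion_boundaryCone [IsNoetherianRing R] (hI : IsXHomogeneous I) :
    ⋃₀ {C | ∃ w : ℝ × (Fin n → ℝ), w.1 < 0 ∧ C = boundaryCone I w} = {0} ×ˢ Set.univ := by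
  refine Set.Subset.antisymm ?_ ?_
  · rintro x ⟨_, ⟨w, -, rfl⟩, hx⟩
    exact hx.2
  · intro u hu
    have hu0 : u.1 = 0 := by simpa using hu
    let v : ℕ → ℝ × (Fin n → ℝ) := fun k => u + (1 / ((k : ℝ) + 1)) • ((-1, 0) : ℝ × (Fin n → ℝ))
    have hv : ∀ k, (v k).1 < 0 := by
      intro k
      simp only [v, Prod.fst_add, Prod.smul_fst, hu0, smul_eq_mul]
      have : (0 : ℝ) < 1 / ((k : ℝ) + 1) := by positivity
      linarith
    obtain ⟨w, hw, hU⟩ := exists_initialIdeal_eq_mem_ultrafilter hI (Filter.hyperfilter ℕ) hv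
    refine ⟨_, ⟨w, hw, rfl⟩, ?_, hu⟩
    have ht : Tendsto v atTop (𝓝 u) := by
      have h1 := (tendsto_one_div_add_atTop_nhds_zero_nat (𝕜 := ℝ)).smul_const
        ((-1, 0) : ℝ × (Fin n → ℝ))
      have h2 := h1.const_add u
      simp only [zero_smul, add_zero] at h2
      exact h2
    refine mem_closure_of_tendsto (ht.mono_left Nat.hyperfilter_le_atTop) ?_
    filter_upwards [hU] with k hk using ⟨hv k, hk⟩

theorem IsCellDescription.isPolyhedron_groebnerSlice (hC : IsCellDescription I w Eq Lt)
    (hw : w.1 < 0) : IsPolyhedron (groebnerSlice I w) := by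
  classical
  let φ : StrongDual ℝ (ℝ × (Fin n → ℝ)) := ContinuousLinearMap.fst ℝ ℝ (Fin n → ℝ)
  refine ⟨Eq.image (fun l => (l, 0)) ∪ Eq.image (fun l => (-l, 0)) ∪ Lt.image (fun l => (l, 0)) ∪
    {(φ, -1), (-φ, 1)}, ?_⟩
  rw [hC.groebnerSlice_eq hw]
  ext x
  simp only [cutSet, levelSet, Set.mem_ofPred_eq, Finset.mem_union, Finset.mem_image,
    Finset.mem_insert, Finset.mem_singleton]
  constructor
  · rintro ⟨⟨h1, h2⟩, h3⟩ p hp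
    rcases hp with ((⟨l, hl, rfl⟩ | ⟨l, hl, rfl⟩) | ⟨l, hl, rfl⟩) | rfl | rfl
    · exact (h2 l hl).le
    · simp [h2 l hl]
    · exact h3 l hl
    · exact h1.le
    · simp [φ, h1]
  · intro h
    refine ⟨⟨?_, fun l hl => ?_⟩, fun l hl => ?_⟩
    · have h1 := h (φ, -1) (by simp)
      have h2 := h (-φ, 1) (by simp)
      simp only [φ, neg_apply, ContinuousLinearMap.coe_fst'] at h1 h2
      linarith
    · have h1 := h (l, 0) (Or.inl (Or.inl (Or.inl ⟨l, hl, rfl⟩)))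
      have h2 := h (-l, 0) (Or.inl (Or.inl (Or.inr ⟨l, hl, rfl⟩)))
      simp only [neg_apply] at h1 h2
      linarith
    · exact h (l, 0) (Or.inl (Or.inr ⟨l, hl, rfl⟩))

theorem IsCellDescription.isPolyhedralCone_boundaryCone (hC : IsCellDescription I w Eq Lt)
    (hw : w.1 < 0) : IsPolyhedralCone (boundaryCone I w) := by
  classical
  let φ : StrongDual ℝ (ℝ × (Fin n → ℝ)) := ContinuousLinearMap.fst ℝ ℝ (Fin n → ℝ)
  refine ⟨Eq ∪ Eq.image (fun l => -l) ∪ Lt ∪ {φ, -φ}, ?_⟩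
  rw [hC.boundaryCone_eq hw]
  ext x
  simp only [cutSet, levelSet, Set.mem_ofPred_eq, Finset.mem_union, Finset.mem_image,
    Finset.mem_insert, Finset.mem_singleton]
  constructor
  · rintro ⟨⟨h1, h2⟩, h3⟩ p hp
    rcases hp with ((hl | ⟨l, hl, rfl⟩) | hl) | rfl | rfl
    · exact (h2 p hl).le
    · simp [h2 l hl]
    · exact h3 p hl
    · exact h1.le
    · simp [φ, h1]
  · intro h
    refine ⟨⟨?_, fun l hl => ?_⟩, fun l hl => ?_⟩
    · have h1 := h φ (by simp)
      have h2 := h (-φ) (by simp)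
      simp only [φ, neg_apply, ContinuousLinearMap.coe_fst'] at h1 h2
      linarith
    · have h1 := h l (Or.inl (Or.inl (Or.inl hl)))
      have h2 := h (-l) (Or.inl (Or.inl (Or.inr ⟨l, hl, rfl⟩)))
      simp only [neg_apply] at h1 h2
      linarith
    · exact h l (Or.inl (Or.inr hl))

theorem exists_forall_tight_inter {A A' : Set (ℝ × (Fin n → ℝ))}
    {L L' : Finset (StrongDual ℝ (ℝ × (Fin n → ℝ)))}
    (hA : ∀ x ∈ A, ∀ y ∈ A, ∀ ε : ℝ, x + ε • (x - y) ∈ A)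
    (hA' : ∀ x ∈ A', ∀ y ∈ A', ∀ ε : ℝ, x + ε • (x - y) ∈ A')
    (hne : (cutSet A L ∩ cutSet A' L').Nonempty) :
    ∃ v ∈ cutSet A L ∩ cutSet A' L', ∀ x ∈ cutSet A L ∩ cutSet A' L',
      (∀ l ∈ L, l v = 0 → l x = 0) ∧ ∀ l ∈ L', l v = 0 → l x = 0 := by
  classical
  obtain ⟨v, hv, hvt⟩ := exists_forall_tight (L ∪ L') hne (by
    rintro x ⟨⟨hx1, hx2⟩, hx3, hx4⟩ y ⟨⟨hy1, hy2⟩, hy3, hy4⟩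
    refine ⟨⟨hA x hx1 y hy1 _, fun l hl => ?_⟩, hA' x hx3 y hy3 _, fun l hl => ?_⟩
    · have h1 := hx2 l hl
      have h2 := hy2 l hl
      simp only [map_add, map_smul, map_sub, smul_eq_mul]
      linarith
    · have h1 := hx4 l hl
      have h2 := hy4 l hl
      simp only [map_add, map_smul, map_sub, smul_eq_mul]
      linarith) (by
    rintro x ⟨⟨-, hx2⟩, -, hx4⟩ l hl
    rcases Finset.mem_union.1 hl with hl | hl
    · exact hx2 l hl
    · exact hx4 l hl)
  exact ⟨v, hv, fun x hx => ⟨fun l hl => hvt x hx l (Finset.mem_union_left _ hl),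
    fun l hl => hvt x hx l (Finset.mem_union_right _ hl)⟩⟩

/-- Two slices that meet do so in the slice of a relative interior point of their intersection,
which is the smallest face of either one containing that point. -/
theorem isPolyhedralComplex_groebnerSlice [IsNoetherianRing R] (hI : IsXHomogeneous I) :
    IsPolyhedralComplex {P | ∃ w : ℝ × (Fin n → ℝ), w.1 < 0 ∧ P = groebnerSlice I w} := by
  refine ⟨?_, ?_, ?_, ?_, ?_⟩
  · refine finite_of_initialIdeal_congr hI fun v w h => ?_
    simp only [groebnerSlice, groebnerCone, h]
  · rintro _ ⟨w, hw, rfl⟩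
    obtain ⟨Eq, Lt, hC⟩ := exists_isCellDescription hI hw
    exact ⟨_, (hC.normalize_mem hw).1⟩
  · rintro _ ⟨w, hw, rfl⟩
    obtain ⟨Eq, Lt, hC⟩ := exists_isCellDescription hI hw
    exact hC.isPolyhedron_groebnerSlice hw
  · rintro _ ⟨w, hw, rfl⟩ F hF
    obtain ⟨Eq, Lt, hC⟩ := exists_isCellDescription hI hw
    have hs := hC.groebnerSlice_eq hw
    rw [hs] at hF
    obtain ⟨v, hv, rfl⟩ := exists_eq_tightFace (levelSet_affine (-1)) hF
    refine ⟨v, by rw [hv.1.1]; norm_num, ?_⟩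
    rw [hC.groebnerSlice_eq_tightFace hI hw (hs ▸ hv)]
  · rintro _ ⟨w, hw, rfl⟩ _ ⟨w', hw', rfl⟩ hne
    obtain ⟨Eq, Lt, hC⟩ := exists_isCellDescription hI hw
    obtain ⟨Eq', Lt', hC'⟩ := exists_isCellDescription hI hw'
    have hs := hC.groebnerSlice_eq hw
    have hs' := hC'.groebnerSlice_eq hw'
    rw [hs, hs'] at hne
    obtain ⟨v, hv, hvt⟩ := exists_forall_tight_inter (levelSet_affine (-1))
      (levelSet_affine (-1)) hne
    have h1 := hC.groebnerSlice_eq_tightFace hI hw (hs ▸ hv.1)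
    have h2 := hC'.groebnerSlice_eq_tightFace hI hw' (hs' ▸ hv.2)
    have h3 : groebnerSlice I w ∩ groebnerSlice I w' = groebnerSlice I v := by
      refine Set.Subset.antisymm ?_ ?_
      · rw [hs, hs', h1]
        exact fun x hx => ⟨hx.1, (hvt x hx).1⟩
      · intro x hx
        refine ⟨?_, ?_⟩
        · rw [h1] at hx
          rw [hs]
          exact hx.1
        · rw [h2] at hx
          rw [hs']
          exact hx.1
    rw [h3]
    refine ⟨?_, ?_⟩
    · rw [h1, hs]
      exact isFaceOf_tightFace hv.1
    · rw [h2, hs']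
      exact isFaceOf_tightFace hv.2

theorem boundaryCone_eq_recessionCone [IsNoetherianRing R] (hI : IsXHomogeneous I)
    (hw : w.1 < 0) : boundaryCone I w = recessionCone (groebnerSlice I w) := by
  obtain ⟨Eq, Lt, hC⟩ := exists_isCellDescription hI hw
  rw [hC.boundaryCone_eq hw, hC.groebnerSlice_eq hw]
  have hp := (hC.normalize_mem hw).1
  rw [hC.groebnerSlice_eq hw] at hp
  set p := (-w.1)⁻¹ • w
  ext v
  constructor
  · rintro ⟨⟨h1, h2⟩, h3⟩
    refine ⟨h1.le, fun q hq => ⟨⟨by simp [h1, hq.1.1], fun l hl => ?_⟩, fun l hl => ?_⟩⟩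
    · rw [map_add, h2 l hl, hq.1.2 l hl, add_zero]
    · rw [map_add]
      exact add_nonpos (h3 l hl) (hq.2 l hl)
  · rintro ⟨-, hv⟩
    -- Iterating the translation: an inequality with `l v > 0` would fail at `k • v + p` for large
    -- `k`.
    have hk : ∀ k : ℕ, (k : ℝ) • v + p ∈ cutSet (levelSet Eq (-1)) Lt := by
      intro k
      induction k with
      | zero => simpa using hp
      | succ k ih =>
        have := hv _ ih
        rw [← add_assoc] at this
        convert this using 2
        push_cast
        module
    have h1 := hv p hp
    refine ⟨⟨?_, fun l hl => ?_⟩, fun l hl => ?_⟩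
    · have h2 := h1.1.1
      have h3 := hp.1.1
      rw [Prod.fst_add, h3] at h2
      linarith
    · have h2 := h1.1.2 l hl
      rwa [map_add, hp.1.2 l hl, add_zero] at h2
    · by_contra! hpos
      obtain ⟨k, hk'⟩ := exists_nat_gt (-l p / l v)
      rw [div_lt_iff₀ hpos] at hk'
      have := (hk k).2 l hl
      simp only [map_add, map_smul, smul_eq_mul] at this
      linarith

end GroebnerComplex

/-! ### The fan of boundary cones. -/

section BoundaryFan

variable {R : Type*} [CommRing R] {n : ℕ} {I : Ideal (XSeries R n)} {w : ℝ × (Fin n → ℝ)}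
  {Eq Lt : Finset (StrongDual ℝ (ℝ × (Fin n → ℝ)))}

theorem eventually_add_mul_neg {a b : ℝ} (hb : b < 0) : ∀ᶠ s in atTop, a + s * b < 0 := by
  filter_upwards [eventually_gt_atTop (a / -b)] with s hs
  rw [div_lt_iff₀ (by linarith)] at hs
  linarith

/-- Every smallest face of the boundary cone of `w` is the boundary cone of a point of the slice
of `w`. -/
theorem IsCellDescription.exists_boundaryCone_eq_tightFace [IsNoetherianRing R]
    (hI : IsXHomogeneous I) (hC : IsCellDescription I w Eq Lt) (hw : w.1 < 0)
    {x₀ : ℝ × (Fin n → ℝ)} (hx₀ : x₀ ∈ boundaryCone I w) :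
    ∃ v : ℝ × (Fin n → ℝ), v.1 < 0 ∧ boundaryCone I v = tightFace (levelSet Eq 0) Lt x₀ := by
  classical
  have hs := hC.groebnerSlice_eq hw
  rw [hC.boundaryCone_eq hw] at hx₀
  let T : ℝ × (Fin n → ℝ) → Finset (StrongDual ℝ (ℝ × (Fin n → ℝ))) :=
    fun v => Lt.filter fun l => l v = 0
  -- A point of the slice is sought that is tight only where `x₀` is, and at as many such
  -- inequalities as possible. It need not be tight at all of them; the remaining ones must be
  -- implied on the boundary cone.
  let N : Set ℕ := {k | ∃ v ∈ groebnerSlice I w, T v ⊆ T x₀ ∧ (T x₀).card - (T v).card = k}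
  have hN : N.Nonempty := by
    obtain ⟨hp, hp'⟩ := hC.normalize_mem hw
    refine ⟨_, _, hp, fun l hl => ?_, rfl⟩
    have := Finset.mem_filter.1 hl
    exact absurd this.2 (hp' l this.1).ne
  obtain ⟨k, ⟨v, hv, hvT, rfl⟩, hmin⟩ := (wellFounded_lt (α := ℕ)).has_min N hN
  have hvs := hv
  rw [hs] at hvs
  refine ⟨v, by rw [hvs.1.1]; norm_num, ?_⟩
  rw [hC.boundaryCone_eq_tightFace hI hw hv]
  have hTx : ∀ l ∈ Lt, l v = 0 → l x₀ = 0 := fun l hl h =>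
    (Finset.mem_filter.1 (hvT (Finset.mem_filter.2 ⟨hl, h⟩))).2
  refine Set.Subset.antisymm ?_ fun x hx => ⟨hx.1, fun l hl h => hx.2 l hl (hTx l hl h)⟩
  rintro x ⟨hx, hxt⟩
  refine ⟨hx, fun l₀ hl₀ hl₀x => ?_⟩
  by_contra hne
  have hneg : l₀ x < 0 := lt_of_le_of_ne (hx.2 l₀ hl₀) hne
  -- The minimal ratio is the longest step from `v` along `-x` that respects the inequalities tight
  -- at `x₀`, and it makes `l₁` tight. Adding a large multiple of `x₀` repairs the others,
  -- contradicting the choice of `v`.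
  obtain ⟨l₁, hl₁, hl₁min⟩ := Finset.exists_min_image ((T x₀).filter fun l => l x < 0)
    (fun l => l v / l x) ⟨l₀, by simp [T, hl₀, hl₀x, hneg]⟩
  simp only [T, Finset.mem_filter] at hl₁ hl₁min
  obtain ⟨⟨hl₁L, hl₁x₀⟩, hl₁x⟩ := hl₁
  set s := l₁ v / l₁ x with hsdef
  have hs0 : 0 ≤ s := div_nonneg_of_nonpos (hvs.2 l₁ hl₁L) hl₁x.le
  obtain ⟨r, hr⟩ : ∃ r : ℝ, ∀ l ∈ Lt, l x₀ ≠ 0 → (l v - s * l x) + r * l x₀ < 0 := by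
    refine Filter.Eventually.exists (f := (atTop : Filter ℝ)) ?_
    rw [Filter.eventually_all_finset]
    intro l hl
    by_cases h : l x₀ = 0
    · exact Eventually.of_forall fun _ h' => absurd h h'
    · filter_upwards [eventually_add_mul_neg (a := l v - s * l x)
        (lt_of_le_of_ne (hx₀.2 l hl) h)] with r hr _ using hr
  have hval : ∀ l : StrongDual ℝ (ℝ × (Fin n → ℝ)),
      l (v - s • x + r • x₀) = (l v - s * l x) + r * l x₀ := fun l => by
    simp only [map_add, map_sub, map_smul, smul_eq_mul]
  have hmem : v - s • x + r • x₀ ∈ groebnerSlice I w := by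
    rw [hs]
    refine ⟨⟨?_, fun l hl => ?_⟩, fun l hl => ?_⟩
    · simp [hvs.1.1, hx.1.1, hx₀.1.1]
    · rw [hval, hvs.1.2 l hl, hx.1.2 l hl, hx₀.1.2 l hl]
      ring
    · rw [hval]
      by_cases h : l x₀ = 0
      · rw [h, mul_zero, add_zero]
        rcases (hx.2 l hl).lt_or_eq with h1 | h1
        · have := hl₁min l ⟨⟨hl, h⟩, h1⟩
          rw [le_div_iff_of_neg h1] at this
          linarith
        · rw [h1, mul_zero, sub_zero]
          exact hvs.2 l hl
      · exact (hr l hl h).le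
  have hsub : T (v - s • x + r • x₀) ⊆ T x₀ := by
    intro l hl
    simp only [T, Finset.mem_filter, hval] at hl ⊢
    refine ⟨hl.1, ?_⟩
    by_contra h
    exact (hr l hl.1 h).ne hl.2
  refine hmin _ ⟨_, hmem, hsub, rfl⟩ ?_
  have hlt : T v ⊂ T (v - s • x + r • x₀) := by
    rw [Finset.ssubset_iff_of_subset]
    · refine ⟨l₁, ?_, ?_⟩
      · simp only [T, Finset.mem_filter, hval]
        refine ⟨hl₁L, ?_⟩
        rw [hl₁x₀, hsdef, div_mul_cancel₀ _ hl₁x.ne]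
        ring
      · simp only [T, Finset.mem_filter, not_and]
        intro _ h
        exact hl₁x.ne (hxt l₁ hl₁L h)
    · intro l hl
      simp only [T, Finset.mem_filter, hval] at hl ⊢
      refine ⟨hl.1, ?_⟩
      rw [hl.2, hxt l hl.1 hl.2, hTx l hl.1 hl.2]
      ring
  have h1 := Finset.card_lt_card hlt
  have h2 := Finset.card_le_card hsub
  have h3 := Finset.card_le_card hvT
  omega

/-- The smallest face of the convex cone `C` which contains `x₀`. -/
def coneFace (x₀ : ℝ × (Fin n → ℝ)) (C : Set (ℝ × (Fin n → ℝ))) : Set (ℝ × (Fin n → ℝ)) :=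
  {x | x ∈ C ∧ ∃ ε : ℝ, 0 < ε ∧ x₀ + ε • (-x) ∈ C}

/-- The intrinsic description of the smallest face, without inequalities, permits comparing faces of
cones given by different systems. -/
theorem coneFace_cutSet {x₀ : ℝ × (Fin n → ℝ)} (hx₀ : x₀ ∈ cutSet (levelSet Eq 0) Lt) :
    coneFace x₀ (cutSet (levelSet Eq 0) Lt) = tightFace (levelSet Eq 0) Lt x₀ := by
  ext x
  refine and_congr_right fun hx => ⟨?_, ?_⟩
  · rintro ⟨ε, hε, -, h⟩ l hl h0
    have h1 := h l hl
    simp only [map_add, map_smul, map_neg, smul_eq_mul, h0, zero_add, mul_neg] at h1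
    have h2 := hx.2 l hl
    nlinarith
  · intro h
    obtain ⟨ε, hε, h'⟩ := exists_pos_forall_le Lt (y := -x) hx₀.2
      fun l hl h0 => by rw [map_neg, h l hl h0, neg_zero]
    refine ⟨ε, hε, ⟨?_, fun l hl => ?_⟩, h'⟩
    · simp [hx₀.1.1, hx.1.1]
    · simp [hx₀.1.2 l hl, hx.1.2 l hl]

/-- The points of `{-1} × ℝⁿ` from which the ray in direction `x₀` ends up in `P`. -/
def eventualRay (x₀ : ℝ × (Fin n → ℝ)) (P : Set (ℝ × (Fin n → ℝ))) : Set (ℝ × (Fin n → ℝ)) :=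
  {z | z.1 = -1 ∧ ∀ᶠ s : ℝ in atTop, z + s • x₀ ∈ P}

/-- Far along the ray the inequalities strict at `x₀` hold automatically, so only those tight at
`x₀` constrain `z`. In particular the set is closed. -/
theorem IsCellDescription.eventualRay_eq (hC : IsCellDescription I w Eq Lt) (hw : w.1 < 0)
    {x₀ : ℝ × (Fin n → ℝ)} (hx₀ : x₀ ∈ boundaryCone I w) :
    eventualRay x₀ (groebnerSlice I w) =
      {z | z.1 = -1 ∧ (∀ l ∈ Eq, l z = 0) ∧ ∀ l ∈ Lt, l x₀ = 0 → l z ≤ 0} := by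
  rw [hC.boundaryCone_eq hw] at hx₀
  rw [hC.groebnerSlice_eq hw]
  ext z
  refine and_congr_right fun hz => ⟨?_, ?_⟩
  · intro h
    obtain ⟨s, hs⟩ := h.exists
    refine ⟨fun l hl => ?_, fun l hl h0 => ?_⟩
    · have := hs.1.2 l hl
      simpa [hx₀.1.2 l hl] using this
    · have := hs.2 l hl
      simpa [h0] using this
  · rintro ⟨h1, h2⟩
    have : ∀ᶠ s : ℝ in atTop, ∀ l ∈ Lt, l (z + s • x₀) ≤ 0 := by
      rw [Filter.eventually_all_finset]
      intro l hl
      simp only [map_add, map_smul, smul_eq_mul]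
      rcases (hx₀.2 l hl).lt_or_eq with h | h
      · filter_upwards [eventually_add_mul_neg (a := l z) h] with s hs using hs.le
      · exact Eventually.of_forall fun s => by rw [h, mul_zero, add_zero]; exact h2 l hl h
    filter_upwards [this] with s hs
    refine ⟨⟨?_, fun l hl => ?_⟩, hs⟩
    · simp [hz, hx₀.1.1]
    · simp [h1 l hl, hx₀.1.2 l hl]

theorem isClosed_eventualRay [IsNoetherianRing R] (hI : IsXHomogeneous I) (hw : w.1 < 0)
    {x₀ : ℝ × (Fin n → ℝ)} (hx₀ : x₀ ∈ boundaryCone I w) :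
    IsClosed (eventualRay x₀ (groebnerSlice I w)) := by
  obtain ⟨Eq, Lt, hC⟩ := exists_isCellDescription hI hw
  rw [hC.eventualRay_eq hw hx₀]
  simp only [Set.ofPred_and, Set.ofPred_forall]
  refine (isClosed_eq continuous_fst continuous_const).inter (IsClosed.inter ?_ ?_)
  · exact isClosed_biInter fun l _ => isClosed_eq l.continuous continuous_const
  · exact isClosed_biInter fun l _ => isClosed_iInter fun _ =>
      isClosed_le l.continuous continuous_const

theorem eventualRay_nonempty [IsNoetherianRing R] (hI : IsXHomogeneous I) (hw : w.1 < 0)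
    {x₀ : ℝ × (Fin n → ℝ)} (hx₀ : x₀ ∈ boundaryCone I w) :
    (eventualRay x₀ (groebnerSlice I w)).Nonempty := by
  obtain ⟨Eq, Lt, hC⟩ := exists_isCellDescription hI hw
  have hp := (hC.normalize_mem hw).1
  rw [hC.groebnerSlice_eq hw] at hp
  refine ⟨(-w.1)⁻¹ • w, ?_⟩
  rw [hC.eventualRay_eq hw hx₀]
  exact ⟨hp.1.1, hp.1.2, fun l hl _ => hp.2 l hl⟩

/-- Every ray in a direction of the boundary hyperplane ends up in a single slice, whose boundary
cone contains the direction. -/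
theorem exists_mem_eventualRay [IsNoetherianRing R] (hI : IsXHomogeneous I)
    {x₀ z : ℝ × (Fin n → ℝ)} (hx₀ : x₀.1 = 0) (hz : z.1 = -1) :
    ∃ w : ℝ × (Fin n → ℝ), w.1 < 0 ∧ x₀ ∈ boundaryCone I w ∧
      z ∈ eventualRay x₀ (groebnerSlice I w) := by
  have hv : ∀ k : ℕ, (z + (k : ℝ) • x₀).1 < 0 := fun k => by simp [hx₀, hz]
  obtain ⟨w, hw, hU⟩ := exists_initialIdeal_eq_mem_ultrafilter hI (Filter.hyperfilter ℕ) hv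
  obtain ⟨Eq, Lt, hC⟩ := exists_isCellDescription hI hw
  have hge : ∀ N : ℕ, ∃ k ≥ N, (∀ l ∈ Eq, l z + k * l x₀ = 0) ∧ ∀ l ∈ Lt, l z + k * l x₀ < 0 := by
    intro N
    obtain ⟨k, hk1, hk2⟩ := (hU.and
      (Nat.hyperfilter_le_atTop (Filter.eventually_ge_atTop N))).exists
    have := (hC.mem_iff _ (hv k)).1 hk1
    simp only [map_add, map_smul, smul_eq_mul] at this
    exact ⟨k, hk2, this⟩
  -- An affine function of `k` with two distinct zeros vanishes identically.
  have hEq : ∀ l ∈ Eq, l x₀ = 0 ∧ l z = 0 := by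
    intro l hl
    obtain ⟨k, -, hk, -⟩ := hge 0
    obtain ⟨k', hk', hk'', -⟩ := hge (k + 1)
    have h1 := hk l hl
    have h2 := hk'' l hl
    have h3 : (k : ℝ) < k' := by exact_mod_cast hk'
    have h4 : ((k' : ℝ) - k) * l x₀ = 0 := by linarith
    have h5 : l x₀ = 0 := by
      rcases mul_eq_zero.1 h4 with h | h
      · linarith
      · exact h
    exact ⟨h5, by simpa [h5] using h1⟩
  have hLt : ∀ l ∈ Lt, l x₀ ≤ 0 := by
    intro l hl
    by_contra! hpos
    obtain ⟨N, hN⟩ := exists_nat_gt (-l z / l x₀)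
    obtain ⟨k, hk, -, hk'⟩ := hge N
    have h1 := hk' l hl
    have h2 : (N : ℝ) ≤ k := by exact_mod_cast hk
    rw [div_lt_iff₀ hpos] at hN
    nlinarith
  have hmem : x₀ ∈ boundaryCone I w := by
    rw [hC.boundaryCone_eq hw]
    exact ⟨⟨hx₀, fun l hl => (hEq l hl).1⟩, hLt⟩
  refine ⟨w, hw, hmem, ?_⟩
  rw [hC.eventualRay_eq hw hmem]
  refine ⟨hz, fun l hl => (hEq l hl).2, fun l hl h0 => ?_⟩
  obtain ⟨k, -, -, hk⟩ := hge 0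
  have := hk l hl
  rw [h0, mul_zero, add_zero] at this
  exact this.le

/-- For large `s` the point `z + s • x₀` lies in both slices and is tight only where `x₀` is. Its
boundary cone is therefore a face of both boundary cones having the same smallest face at `x₀`. -/
theorem coneFace_eq_of_eventualRay [IsNoetherianRing R] (hI : IsXHomogeneous I)
    {w' x₀ z : ℝ × (Fin n → ℝ)} (hw : w.1 < 0) (hw' : w'.1 < 0)
    (hx₀ : x₀ ∈ boundaryCone I w) (hx₀' : x₀ ∈ boundaryCone I w')
    (hz : z ∈ eventualRay x₀ (groebnerSlice I w))
    (hz' : z ∈ eventualRay x₀ (groebnerSlice I w')) :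
    coneFace x₀ (boundaryCone I w) = coneFace x₀ (boundaryCone I w') := by
  have key : ∀ u : ℝ × (Fin n → ℝ), u.1 < 0 → x₀ ∈ boundaryCone I u → ∀ᶠ s : ℝ in atTop,
      z + s • x₀ ∈ groebnerSlice I u →
        coneFace x₀ (boundaryCone I (z + s • x₀)) = coneFace x₀ (boundaryCone I u) := by
    intro u hu hxu
    obtain ⟨Eq, Lt, hC⟩ := exists_isCellDescription hI hu
    have hbu := hC.boundaryCone_eq hu
    have hxu' := hxu
    rw [hbu] at hxu'
    have hev : ∀ᶠ s : ℝ in atTop, ∀ l ∈ Lt, l x₀ ≠ 0 → l z + s * l x₀ < 0 := by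
      rw [Filter.eventually_all_finset]
      intro l hl
      by_cases h : l x₀ = 0
      · exact Eventually.of_forall fun _ h' => absurd h h'
      · filter_upwards [eventually_add_mul_neg (a := l z)
          (lt_of_le_of_ne (hxu'.2 l hl) h)] with s hs _ using hs
    filter_upwards [hev] with s hs hmem
    have hface := hC.boundaryCone_eq_tightFace hI hu hmem
    have htight : ∀ l ∈ Lt, l (z + s • x₀) = 0 → l x₀ = 0 := by
      intro l hl h
      by_contra h0
      have := hs l hl h0
      simp only [map_add, map_smul, smul_eq_mul] at h
      exact this.ne h
    rw [hface, hbu]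
    ext x
    constructor
    · rintro ⟨hx, ε, hε, hxε⟩
      exact ⟨hx.1, ε, hε, hxε.1⟩
    · rintro ⟨hx, ε, hε, hxε⟩
      have hx0 : ∀ l ∈ Lt, l x₀ = 0 → l x = 0 := by
        have : x ∈ coneFace x₀ (cutSet (levelSet Eq 0) Lt) := ⟨hx, ε, hε, hxε⟩
        rw [coneFace_cutSet hxu'] at this
        exact this.2
      refine ⟨⟨hx, fun l hl h => hx0 l hl (htight l hl h)⟩, ε, hε, hxε, fun l hl h => ?_⟩
      have := htight l hl h
      simp [this, hx0 l hl this]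
  obtain ⟨s, ⟨h1, h2⟩, h3, h4⟩ := (((key w hw hx₀).and (key w' hw' hx₀')).and
    (hz.2.and hz'.2)).exists
  exact (h1 h3).symm.trans (h2 h4)

/-- The smallest face which contains a point of the boundary hyperplane does not depend on the
boundary cone containing it. -/
theorem coneFace_boundaryCone_eq [IsNoetherianRing R] (hI : IsXHomogeneous I)
    {w' x₀ : ℝ × (Fin n → ℝ)} (hw : w.1 < 0) (hw' : w'.1 < 0)
    (hx₀ : x₀ ∈ boundaryCone I w) (hx₀' : x₀ ∈ boundaryCone I w') :
    coneFace x₀ (boundaryCone I w) = coneFace x₀ (boundaryCone I w') := by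
  by_contra hne
  have hx1 : x₀.1 = 0 := by simpa using hx₀.2
  let Y : Set (Set (ℝ × (Fin n → ℝ))) := {D | ∃ u : ℝ × (Fin n → ℝ), (u.1 < 0 ∧
    x₀ ∈ boundaryCone I u ∧ coneFace x₀ (boundaryCone I u) = coneFace x₀ (boundaryCone I w)) ∧
      D = eventualRay x₀ (groebnerSlice I u)}
  let Y' : Set (Set (ℝ × (Fin n → ℝ))) := {D | ∃ u : ℝ × (Fin n → ℝ), (u.1 < 0 ∧
    x₀ ∈ boundaryCone I u ∧ coneFace x₀ (boundaryCone I u) ≠ coneFace x₀ (boundaryCone I w)) ∧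
      D = eventualRay x₀ (groebnerSlice I u)}
  have hfin : {D | ∃ u : ℝ × (Fin n → ℝ), u.1 < 0 ∧
      D = eventualRay x₀ (groebnerSlice I u)}.Finite :=
    finite_of_initialIdeal_congr hI fun v w h => by simp only [groebnerSlice, groebnerCone, h]
  have hY : IsClosed (⋃₀ Y) := by
    rw [Set.sUnion_eq_biUnion]
    refine Set.Finite.isClosed_biUnion (hfin.subset ?_) ?_
    · rintro D ⟨u, hu, rfl⟩
      exact ⟨u, hu.1, rfl⟩
    · rintro D ⟨u, hu, rfl⟩
      exact isClosed_eventualRay hI hu.1 hu.2.1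
  have hY' : IsClosed (⋃₀ Y') := by
    rw [Set.sUnion_eq_biUnion]
    refine Set.Finite.isClosed_biUnion (hfin.subset ?_) ?_
    · rintro D ⟨u, hu, rfl⟩
      exact ⟨u, hu.1, rfl⟩
    · rintro D ⟨u, hu, rfl⟩
      exact isClosed_eventualRay hI hu.1 hu.2.1
  have hconn : IsPreconnected {z : ℝ × (Fin n → ℝ) | z.1 = -1} := by
    refine Convex.isPreconnected ?_
    intro x hx y hy a b _ _ hab
    simp only [Set.mem_ofPred_eq] at hx hy ⊢
    simp only [Prod.fst_add, Prod.smul_fst, hx, hy, smul_eq_mul]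
    linarith
  -- If both face types occurred, two closed nonempty sets would cover the connected hyperplane and
  -- hence meet; at a common point the faces agree.
  obtain ⟨z, -, ⟨_, ⟨u, hu, rfl⟩, hz⟩, _, ⟨u', hu', rfl⟩, hz'⟩ :=
    isPreconnected_closed_iff.1 hconn _ _ hY hY' (by
      intro z hz
      obtain ⟨u, hu, hxu, hzu⟩ := exists_mem_eventualRay hI hx1 hz
      by_cases h : coneFace x₀ (boundaryCone I u) = coneFace x₀ (boundaryCone I w)
      · exact Or.inl ⟨_, ⟨u, ⟨hu, hxu, h⟩, rfl⟩, hzu⟩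
      · exact Or.inr ⟨_, ⟨u, ⟨hu, hxu, h⟩, rfl⟩, hzu⟩) (by
      obtain ⟨z, hz⟩ := eventualRay_nonempty hI hw hx₀
      exact ⟨z, hz.1, _, ⟨w, ⟨hw, hx₀, rfl⟩, rfl⟩, hz⟩) (by
      obtain ⟨z, hz⟩ := eventualRay_nonempty hI hw' hx₀'
      exact ⟨z, hz.1, _, ⟨w', ⟨hw', hx₀', Ne.symm hne⟩, rfl⟩, hz⟩)
  exact hu'.2.2 ((coneFace_eq_of_eventualRay hI hu'.1 hu.1 hu'.2.1 hu.2.1 hz' hz).trans hu.2.2)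

theorem isPolyhedralFan_boundaryCone [IsNoetherianRing R] (hI : IsXHomogeneous I) :
    IsPolyhedralFan {C | ∃ w : ℝ × (Fin n → ℝ), w.1 < 0 ∧ C = boundaryCone I w} := by
  refine ⟨?_, ?_, ?_, ?_⟩
  · refine finite_of_initialIdeal_congr hI fun v w h => ?_
    simp only [boundaryCone, groebnerCone, h]
  · rintro _ ⟨w, hw, rfl⟩
    obtain ⟨Eq, Lt, hC⟩ := exists_isCellDescription hI hw
    exact hC.isPolyhedralCone_boundaryCone hw
  · rintro _ ⟨w, hw, rfl⟩ F hF
    obtain ⟨Eq, Lt, hC⟩ := exists_isCellDescription hI hw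
    have hb := hC.boundaryCone_eq hw
    rw [hb] at hF
    obtain ⟨x₀, hx₀, rfl⟩ := exists_eq_tightFace (levelSet_affine 0) hF
    obtain ⟨v, hv, hvF⟩ := hC.exists_boundaryCone_eq_tightFace hI hw (hb ▸ hx₀)
    exact ⟨v, hv, hvF.symm⟩
  · rintro _ ⟨w, hw, rfl⟩ _ ⟨w', hw', rfl⟩
    obtain ⟨Eq, Lt, hC⟩ := exists_isCellDescription hI hw
    obtain ⟨Eq', Lt', hC'⟩ := exists_isCellDescription hI hw'
    have hb := hC.boundaryCone_eq hw
    have hb' := hC'.boundaryCone_eq hw'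
    have hzero : ∀ {Eq Lt : Finset (StrongDual ℝ (ℝ × (Fin n → ℝ)))},
        (0 : ℝ × (Fin n → ℝ)) ∈ cutSet (levelSet Eq 0) Lt :=
      ⟨⟨rfl, fun l _ => map_zero l⟩, fun l _ => (map_zero l).le⟩
    obtain ⟨x₀, ⟨hx, hx'⟩, ht⟩ := exists_forall_tight_inter (L := Lt) (L' := Lt')
      (levelSet_affine (Eq := Eq) 0) (levelSet_affine (Eq := Eq') 0) ⟨0, hzero, hzero⟩
    have hface := coneFace_boundaryCone_eq hI hw hw' (hb ▸ hx) (hb' ▸ hx')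
    rw [hb, hb', coneFace_cutSet hx, coneFace_cutSet hx'] at hface
    -- Since `x₀` is relatively interior to the intersection, the intersection lies in the smallest
    -- face at `x₀`; conversely that face is common to both cones.
    have h3 : boundaryCone I w ∩ boundaryCone I w' = tightFace (levelSet Eq 0) Lt x₀ := by
      rw [hb, hb']
      refine Set.Subset.antisymm (fun x hx => ⟨hx.1, (ht x hx).1⟩) fun x hx => ⟨hx.1, ?_⟩
      rw [hface] at hx
      exact hx.1
    rw [h3]
    refine ⟨?_, ?_⟩
    · rw [hb]
      exact isFaceOf_tightFace hx
    · rw [hface, hb']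
      exact isFaceOf_tightFace hx'

end BoundaryFan

theorem proposition3p17 {R : Type*} [CommRing R] [IsNoetherianRing R] {n : ℕ}
    (I : Ideal (MvPolynomial (Fin n) (PowerSeries R))) (hI : IsXHomogeneous I) :
    (IsPolyhedralComplex {P | ∃ w : ℝ × (Fin n → ℝ), w.1 < 0 ∧ P = groebnerSlice I w} ∧
      ⋃₀ {P | ∃ w : ℝ × (Fin n → ℝ), w.1 < 0 ∧ P = groebnerSlice I w} = {-1} ×ˢ Set.univ) ∧
    (∀ w : ℝ × (Fin n → ℝ), w.1 < 0 → boundaryCone I w = recessionCone (groebnerSlice I w)) ∧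
    (IsPolyhedralFan {C | ∃ w : ℝ × (Fin n → ℝ), w.1 < 0 ∧ C = boundaryCone I w} ∧
      ⋃₀ {C | ∃ w : ℝ × (Fin n → ℝ), w.1 < 0 ∧ C = boundaryCone I w} = {0} ×ˢ Set.univ) :=
  ⟨⟨isPolyhedralComplex_groebnerSlice hI, sUnion_groebnerSlice⟩,
    fun _ hw => boundaryCone_eq_recessionCone hI hw,
    isPolyhedralFan_boundaryCone hI, sUnion_boundaryCone hI⟩
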